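/- Let $\alpha\in(0,1)$ and $\beta\in\mathbb R$. Write $L^2=L^2(\mathbb R^2;\mathbb C)$, $\mathbf r=(x,y)$, $r=|\mathbf r|$, $\mathbf r^\perp=(-y,x)$, and let $L^2_{\rm even}$ be the set of $\psi\in L^2$ with $\psi(-\mathbf r)=\psi(\mathbf r)$ a.e. Put $\mathbf D_\alpha=-i\nabla+\alpha\,\mathbf r^\perp/r^2$, taken in the sense of distributions on $\mathbb R^2\setminus\{0\}$, and $\mathcal F_\alpha[\psi]=\int_{\mathbb R^2}|\mathbf D_\alpha\psi|^2\,d\mathbf r$ whenever $\mathbf D_\alpha\psi\in L^2$. Let $\mathscr D_{\rm F}$ (the Friedrichs form domain) be the set of $\psi\in L^2_{\rm even}$ with $\mathcal F_\alpha[\psi]<\infty$ such that for every $\varepsilon>0$ there is $\eta\in C_0^\infty(\mathbb R^2\setminus\{0\})$ with $\mathcal F_\alpha[\psi-\eta]<\varepsilon$. For $\lambda>0$ let $G_\lambda(\mathbf r)=\lambda^\alpha K_\alpha(\lambda r)$, with $K_\alpha$ the modified Bessel function of the second kind, and let $c_\alpha=\frac{2\pi}{\alpha}\int_0^\infty r\,K_\alpha(r)^2\,dr$.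 Define $$\mathscr D[\mathcal F_{\alpha,\beta}]=\{\psi\in L^2_{\rm even}:\ \psi=\phi_\lambda+qG_\lambda,\ \phi_\lambda\in\mathscr D_{\rm F},\ q\in\mathbb C\},$$ $$\mathcal F_{\alpha,\beta}[\psi]=\mathcal F_\alpha[\phi_\lambda]-2\lambda^2\,\mathrm{Re}\big(q\langle\phi_\lambda,G_\lambda\rangle\big)+\big[\beta+(1-\alpha)c_\alpha\lambda^{2\alpha}\big]|q|^2,$$ where $\langle f,g\rangle=\int_{\mathbb R^2}\overline f\,g$. **Theorem.** The domain $\mathscr D[\mathcal F_{\alpha,\beta}]$ and the value $\mathcal F_{\alpha,\beta}[\psi]$ depend neither on the choice of $\lambda>0$ nor on the decomposition of $\psi$. The form $\mathcal F_{\alpha,\beta}$ is closed on $\mathscr D[\mathcal F_{\alpha,\beta}]$: if $\psi_n\in\mathscr D[\mathcal F_{\alpha,\beta}]$, $\psi_n\to\psi$ in $L^2$ and $\mathcal F_{\alpha,\beta}[\psi_n-\psi_m]\to0$ as $n,m\to\infty$, then $\psi\in\mathscr D[\mathcal F_{\alpha,\beta}]$ and $\mathcal F_{\alpha,\beta}[\psi_n-\psi]\to0$.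 It is bounded from below: for all $\psi\in\mathscr D[\mathcal F_{\alpha,\beta}]$, $$\mathcal F_{\alpha,\beta}[\psi]\ \ge\ \begin{cases}0, & \beta\ge0,\\[2pt] -\Big(\dfrac{|\beta|\sin(\pi\alpha)}{\pi^2}\Big)^{1/\alpha}\,\|\psi\|_{L^2}^2, & \beta<0.\end{cases}$$ -/

import Mathlib

open MeasureTheory Filter Set
open scoped Topology ENNReal ContDiff

noncomputable section

/-- The Euclidean plane. -/
abbrev Plane : Type := EuclideanSpace ℝ (Fin 2)

/-- The complex Hilbert space of square-integrable functions on the plane. -/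
abbrev L2 : Type := Lp ℂ 2 (volume : Measure Plane)

/-- Square-integrable `ℂ²`-valued fields on the plane. -/
abbrev L2Field : Type := Lp (EuclideanSpace ℂ (Fin 2)) 2 (volume : Measure Plane)

/-- The even square-integrable functions. -/
def L2even : Set L2 := {ψ | ∀ᵐ x : Plane, ψ (-x) = ψ x}

/-- The `j`-th component of the Aharonov-Bohm potential `α r^⊥ / r²`, where
`(x, y)^⊥ = (-y, x)`. -/
def abPotential (α : ℝ) (x : Plane) (j : Fin 2) : ℝ :=
  α * (!₂[-x 1, x 0] : Plane) j / ‖x‖ ^ 2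

/-- The class `C₀^∞(ℝ² ∖ {0})`. -/
def IsTestFunction (η : Plane → ℂ) : Prop :=
  ContDiff ℝ ∞ η ∧ HasCompactSupport η ∧ tsupport η ⊆ {0}ᶜ

/-- The partial derivative in the `j`-th coordinate direction. -/
def partialDeriv (j : Fin 2) (η : Plane → ℂ) (x : Plane) : ℂ :=
  fderiv ℝ η x (EuclideanSpace.single j 1)

/-- The magnetic gradient `D_α η = (-i ∇ + α r^⊥ / r²) η` of a differentiable function. -/
def magGrad (α : ℝ) (η : Plane → ℂ) (x : Plane) : EuclideanSpace ℂ (Fin 2) :=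
  WithLp.toLp 2 fun j => -Complex.I * partialDeriv j η x + (abPotential α x j : ℂ) * η x

/-- `v = D_α ψ` in the sense of distributions on `ℝ² ∖ {0}`. -/
def HasWeakMagGrad (α : ℝ) (ψ : L2) (v : L2Field) : Prop :=
  ∀ η : Plane → ℂ, IsTestFunction η → ∀ j : Fin 2,
    ∫ x, η x * v x j =
      ∫ x, ψ x * (Complex.I * partialDeriv j η x + (abPotential α x j : ℂ) * η x)

/-- The distributional magnetic gradient is unique. -/
theorem HasWeakMagGrad.unique {α : ℝ} {ψ : L2} {v w : L2Field}
    (hv : HasWeakMagGrad α ψ v) (hw : HasWeakMagGrad α ψ w) : v = w := by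
  have hcomp : ∀ (u : L2Field) (j : Fin 2), LocallyIntegrable (fun x => u x j) volume := by
    intro u j
    have h1 : MemLp (fun x => u x j) 2 volume := by
      refine (Lp.memLp u).mono ?_ (Eventually.of_forall fun x => PiLp.norm_apply_le (u x) j)
      exact (EuclideanSpace.proj (𝕜 := ℂ) j).continuous.comp_aestronglyMeasurable
        (Lp.memLp u).aestronglyMeasurable
    exact h1.locallyIntegrable (by norm_num)
  have key : ∀ j : Fin 2, ∀ᵐ x : Plane, v x j = w x j := by
    intro j
    have hU : IsOpen ({0}ᶜ : Set Plane) := isOpen_compl_singleton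
    have h0 : ∀ᵐ x : Plane, x ∈ ({0}ᶜ : Set Plane) → v x j - w x j = 0 := by
      refine hU.ae_eq_zero_of_integral_contDiff_smul_eq_zero
        (f := fun x => v x j - w x j)
        (((hcomp v j).sub (hcomp w j)).locallyIntegrableOn _) ?_
      intro g hg hgc hgs
      have ht : IsTestFunction (fun x => (g x : ℂ)) := by
        refine ⟨Complex.ofRealCLM.contDiff.comp hg,
          HasCompactSupport.comp_left (g := fun r : ℝ => (r : ℂ)) hgc Complex.ofReal_zero, ?_⟩
        refine (closure_mono fun x hx => ?_).trans hgs
        intro h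
        exact hx (by change (g x : ℂ) = 0; rw [h, Complex.ofReal_zero])
      have e := (hv _ ht j).trans (hw _ ht j).symm
      have hi : ∀ u : L2Field, Integrable (fun x => (g x : ℂ) * u x j) volume := fun u => by
        simpa using (hcomp u j).integrable_smul_left_of_hasCompactSupport hg.continuous hgc
      have : ∫ x, ((g x : ℂ) * v x j - (g x : ℂ) * w x j) = 0 := by
        rw [integral_sub (hi v) (hi w), e, sub_self]
      simpa [mul_sub] using this
    filter_upwards [h0, (measure_eq_zero_iff_ae_notMem.1
      (measure_singleton (μ := (volume : Measure Plane)) 0))] with x hx hx0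
    exact sub_eq_zero.1 (hx hx0)
  refine Lp.ext ?_
  filter_upwards [key 0, key 1] with x h0 h1
  ext j
  fin_cases j
  · exact h0
  · exact h1

open Classical in
/-- The distributional magnetic gradient `D_α ψ`, if it is square-integrable (and `0` otherwise). -/
def weakMagGrad (α : ℝ) (ψ : L2) : L2Field :=
  if h : ∃ v, HasWeakMagGrad α ψ v then h.choose else 0

/-- The form `F_α[ψ] = ∫ |D_α ψ|²`. -/
def magForm (α : ℝ) (ψ : L2) : ℝ := ∫ x, ‖weakMagGrad α ψ x‖ ^ 2

/-- The domain of the Friedrichs form: the even square-integrable functions `ψ` with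
`F_α[ψ] < ∞` that lie in the closure of `C₀^∞(ℝ² ∖ {0})` for the norm `F_α[·]^{1/2}`. -/
def friedrichsDomain (α : ℝ) : Set L2 :=
  {ψ | ψ ∈ L2even ∧ ∃ v : L2Field, HasWeakMagGrad α ψ v ∧
    ∀ ε : ℝ≥0∞, 0 < ε → ∃ η : Plane → ℂ, IsTestFunction η ∧
      eLpNorm (fun x => magGrad α η x - v x) 2 volume < ε}

/-- The modified Bessel function of the second kind `K_ν(z)`, for `z > 0`. -/
def besselK (ν z : ℝ) : ℝ :=
  ∫ t in Ioi (0 : ℝ), Real.exp (-z * Real.cosh t) * Real.cosh (ν * t)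

/-- The defect function `G_λ(r) = λ^α K_α(λ r)`. -/
def defectFun (α lam : ℝ) (x : Plane) : ℝ := lam ^ α * besselK α (lam * ‖x‖)

/-- The constant `c_α = (2π / α) ∫₀^∞ r K_α(r)² dr`. -/
def cConst (α : ℝ) : ℝ := 2 * Real.pi / α * ∫ r in Ioi (0 : ℝ), r * besselK α r ^ 2

/-- `ψ = φ + q G_λ` with `φ` in the domain of the Friedrichs form. -/
def IsDecomposition (α lam : ℝ) (ψ φ : L2) (q : ℂ) : Prop :=
  φ ∈ friedrichsDomain α ∧ ∀ᵐ x : Plane, ψ x = φ x + q * (defectFun α lam x : ℂ)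

/-- The domain of the form `F_{α,β}`. -/
def anyonDomain (α lam : ℝ) : Set L2 :=
  {ψ | ψ ∈ L2even ∧ ∃ (φ : L2) (q : ℂ), IsDecomposition α lam ψ φ q}

/-- The expression
`F_α[φ] - 2 λ² Re (q ⟨φ, G_λ⟩) + (β + (1 - α) c_α λ^{2α}) |q|²`. -/
def anyonExpr (α β lam : ℝ) (φ : L2) (q : ℂ) : ℝ :=
  magForm α φ
    - 2 * lam ^ 2 * (q * ∫ x, (starRingEnd ℂ) (φ x) * (defectFun α lam x : ℂ)).re
    + (β + (1 - α) * cConst α * lam ^ (2 * α)) * ‖q‖ ^ 2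

open Classical in
/-- The form `F_{α,β}[ψ]`, computed from the decomposition `ψ = φ + q G_λ` (and `0` off its
domain). -/
def anyonForm (α β lam : ℝ) (ψ : L2) : ℝ :=
  if h : ∃ p : L2 × ℂ, IsDecomposition α lam ψ p.1 p.2 then
    anyonExpr α β lam h.choose.1 h.choose.2
  else 0

/-- Closedness of a form `Q` with domain `D`: if `u n ∈ D` converges to `w` in `L²` and
`Q[u n - u m] → 0` as `n, m → ∞`, then `w ∈ D` and `Q[u n - w] → 0`. -/
def IsClosedForm (D : Set L2) (Q : L2 → ℝ) : Prop :=
  ∀ (u : ℕ → L2) (w : L2), (∀ n, u n ∈ D) → Tendsto u atTop (𝓝 w) →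
    Tendsto (fun p : ℕ × ℕ => Q (u p.1 - u p.2)) atTop (𝓝 0) →
      w ∈ D ∧ Tendsto (fun n => Q (u n - w)) atTop (𝓝 0)

/-- `Q[ψ] ≥ m ‖ψ‖²` for all `ψ` in the domain `D`. -/
def IsLowerBoundForm (D : Set L2) (Q : L2 → ℝ) (m : ℝ) : Prop :=
  ∀ ψ ∈ D, m * ‖ψ‖ ^ 2 ≤ Q ψ

end

/-! Write `ψ = φ + q G_μ` with `φ` in the Friedrichs domain and `v = D_α φ`. Since `μ² ‖G_μ‖² = α
c_α μ^{2α}`, expanding `‖φ + q G_μ‖²` absorbs the cross term and gives `F_{α,β}[ψ] + μ² ‖ψ‖² = ‖v‖²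
+ μ² ‖φ‖² + (β + c_α μ^{2α}) |q|²` (`anyonForm_eq_sum_sq`). As `μ > 0` is free, this identity yields
both properties of the form. If `β + c_α μ^{2α} ≥ 0`, then `-μ²` is a lower bound: let `μ → 0` when
`β ≥ 0`, and make the coefficient vanish when `β < 0`. If the coefficient is positive, convergence
of the form makes `v_n`, `φ_n` and `q_n` Cauchy, and the graph of the Friedrichs gradient is closed.

Freedom in `μ` rests on two facts. The singularities of `G_λ` and `G_μ` at the origin cancel, so
`G_λ - G_μ` is in the Friedrichs domain and satisfies Green's formula
(`exists_gradient_defectLp_sub`). Moreover `(λ² - μ²) ⟨G_λ, G_μ⟩ = c_α (λ^{2α} - μ^{2α})`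
(`integral_defectProfile_mul_sub`). Together they show that the expression is the same for `λ` and
`μ` (`exists_anyonExpr_eq`). For fixed `μ` the decomposition is unique because `G_μ` has infinite
energy: a radial function `f` of finite energy has `f / r` in `L²`, the angular part of `D_α f`
being `α f / r`.

All explicit computations use `G_λ = 2^{α-1} s^{α/2} ∫₀^∞ t^{-α-1} exp(-s/t - λ² t/4) dt` with `s =
r²`. Scalar products then become Gamma integrals, and the reflection formula gives `c_α = π² /
sin(πα)`. -/

/-! ### Pairings with square-integrable functions -/

/-- Integration against a square-integrable function is a continuous linear functional on `L²`. -/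
theorem exists_clm_integral_mul {h : Plane → ℂ} (hh : MemLp h 2 volume) :
    ∃ L : L2 →L[ℂ] ℂ, ∀ ψ : L2, ∫ x, h x * ψ x = L ψ := by
  refine ⟨innerSL ℂ (hh.star.toLp (star h)), fun ψ => ?_⟩
  rw [innerSL_apply_apply, L2.inner_def]
  refine integral_congr_ae ?_
  filter_upwards [hh.star.coeFn_toLp] with x hx
  rw [hx]
  simp [mul_comm]

/-- The `j`-th component of a square-integrable field. -/
noncomputable def fieldComp (j : Fin 2) : L2Field →L[ℂ] L2 :=
  (EuclideanSpace.proj (𝕜 := ℂ) j : EuclideanSpace ℂ (Fin 2) →L[ℂ] ℂ).compLpL 2 volume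

theorem coeFn_fieldComp (j : Fin 2) (v : L2Field) :
    ∀ᵐ x : Plane, fieldComp j v x = v x j :=
  ContinuousLinearMap.coeFn_compLpL _ v

theorem exists_clm_integral_mul_comp {h : Plane → ℂ} (hh : MemLp h 2 volume) (j : Fin 2) :
    ∃ L : L2Field →L[ℂ] ℂ, ∀ v : L2Field, ∫ x, h x * v x j = L v := by
  obtain ⟨L, hL⟩ := exists_clm_integral_mul hh
  refine ⟨L.comp (fieldComp j), fun v => ?_⟩
  rw [ContinuousLinearMap.comp_apply, ← hL]
  refine integral_congr_ae ?_
  filter_upwards [coeFn_fieldComp j v] with x hx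
  rw [hx]

/-! ### Test functions -/

theorem IsTestFunction.memLp {η : Plane → ℂ} (hη : IsTestFunction η) (p : ℝ≥0∞) :
    MemLp η p volume :=
  hη.1.continuous.memLp_of_hasCompactSupport hη.2.1

theorem contDiffAt_abPotential (α : ℝ) (j : Fin 2) {x : Plane} (hx : x ≠ 0) :
    ContDiffAt ℝ ∞ (fun x => abPotential α x j) x := by
  have h0 : ∀ i : Fin 2, ContDiff ℝ ∞ (fun x : Plane => x i) := fun i =>
    (EuclideanSpace.proj (𝕜 := ℝ) i : Plane →L[ℝ] ℝ).contDiff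
  have h1 : ContDiff ℝ ∞ (fun x : Plane => (!₂[-x 1, x 0] : Plane) j) := by
    fin_cases j
    · exact (h0 1).neg
    · exact h0 0
  have h2 : ContDiff ℝ ∞ (fun x : Plane => ‖x‖ ^ 2) := contDiff_norm_sq ℝ
  exact ((contDiff_const.mul h1).contDiffAt).div h2.contDiffAt (by simpa using hx)

theorem contDiff_of_contDiffAt_tsupport {E F : Type*} [NormedAddCommGroup E] [NormedSpace ℝ E]
    [NormedAddCommGroup F] [NormedSpace ℝ F] {f : E → F}
    (hf : ∀ x ∈ tsupport f, ContDiffAt ℝ ∞ f x) : ContDiff ℝ ∞ f := by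
  refine contDiff_iff_contDiffAt.2 fun x => ?_
  by_cases hx : x ∈ tsupport f
  · exact hf x hx
  · exact contDiffAt_const.congr_of_eventuallyEq (notMem_tsupport_iff_eventuallyEq.1 hx)

/-- The potential is singular only at the origin, which the support of `η` avoids. -/
theorem IsTestFunction.potential_mul {η : Plane → ℂ} (hη : IsTestFunction η) (α : ℝ) (j : Fin 2) :
    IsTestFunction (fun x => (abPotential α x j : ℂ) * η x) := by
  have hs : tsupport (fun x => (abPotential α x j : ℂ) * η x) ⊆ tsupport η :=
    tsupport_mul_subset_right
  refine ⟨contDiff_of_contDiffAt_tsupport fun x hx => ?_, hη.2.1.mul_left, hs.trans hη.2.2⟩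
  have hx0 : x ≠ 0 := hη.2.2 (hs hx)
  exact (Complex.ofRealCLM.contDiff.contDiffAt.comp x (contDiffAt_abPotential α j hx0)).mul
    hη.1.contDiffAt

theorem IsTestFunction.partialDeriv {η : Plane → ℂ} (hη : IsTestFunction η) (j : Fin 2) :
    IsTestFunction (partialDeriv j η) := by
  refine ⟨?_, hη.2.1.fderiv_apply (𝕜 := ℝ) _, ?_⟩
  · exact (hη.1.fderiv_right (m := ∞) (by simp)).clm_apply contDiff_const
  · refine (closure_minimal (fun x hx => ?_) (isClosed_tsupport η)).trans hη.2.2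
    by_contra hc
    apply hx
    have : fderiv ℝ η x = 0 := by
      by_contra h
      exact hc (support_fderiv_subset ℝ h)
    simp [_root_.partialDeriv, this]

theorem IsTestFunction.const_mul {η : Plane → ℂ} (hη : IsTestFunction η) (c : ℂ) :
    IsTestFunction (fun x => c * η x) :=
  ⟨contDiff_const.mul hη.1, hη.2.1.mul_left, (tsupport_mul_subset_right).trans hη.2.2⟩

theorem IsTestFunction.add {η ξ : Plane → ℂ} (hη : IsTestFunction η) (hξ : IsTestFunction ξ) :
    IsTestFunction (fun x => η x + ξ x) :=
  ⟨hη.1.add hξ.1, hη.2.1.add hξ.2.1,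
    (tsupport_add η ξ).trans (union_subset hη.2.2 hξ.2.2)⟩

theorem IsTestFunction.memLp_dual {η : Plane → ℂ} (hη : IsTestFunction η) (α : ℝ) (j : Fin 2) :
    MemLp (fun x => Complex.I * _root_.partialDeriv j η x + (abPotential α x j : ℂ) * η x) 2
      volume :=
  (((hη.partialDeriv j).const_mul _).add (hη.potential_mul α j)).memLp 2

theorem IsTestFunction.memLp_magGrad {η : Plane → ℂ} (hη : IsTestFunction η) (α : ℝ) :
    MemLp (magGrad α η) 2 volume := by
  refine MemLp.of_eval_piLp fun j => ?_
  exact (((hη.partialDeriv j).const_mul (-Complex.I)).add (hη.potential_mul α j)).memLp 2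

theorem IsTestFunction.magGrad_add {η ξ : Plane → ℂ} (hη : IsTestFunction η)
    (hξ : IsTestFunction ξ) (α : ℝ) (x : Plane) :
    magGrad α (fun x => η x + ξ x) x = magGrad α η x + magGrad α ξ x := by
  ext j
  have : _root_.partialDeriv j (fun x => η x + ξ x) x =
      _root_.partialDeriv j η x + _root_.partialDeriv j ξ x := by
    simp only [_root_.partialDeriv]
    rw [fderiv_fun_add (hη.1.differentiable (by simp) x) (hξ.1.differentiable (by simp) x)]
    rfl
  simp only [magGrad, this, PiLp.add_apply]
  ring

theorem IsTestFunction.magGrad_const_mul {η : Plane → ℂ} (hη : IsTestFunction η)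
    (c : ℂ) (α : ℝ) (x : Plane) :
    magGrad α (fun x => c * η x) x = c • magGrad α η x := by
  ext j
  have : _root_.partialDeriv j (fun x => c * η x) x = c * _root_.partialDeriv j η x := by
    simp only [_root_.partialDeriv]
    rw [fderiv_const_mul (hη.1.differentiable (by simp) x)]
    rfl
  simp only [magGrad, this, PiLp.smul_apply, smul_eq_mul]
  ring

theorem isTestFunction_zero : IsTestFunction (fun _ => 0) :=
  ⟨contDiff_const, HasCompactSupport.zero, by simp [tsupport]⟩

theorem magGrad_zero (α : ℝ) (x : Plane) : magGrad α (fun _ => 0) x = 0 := by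
  ext j
  simp [magGrad, partialDeriv]

/-! ### The graph of the Friedrichs gradient -/

/-- The magnetic gradients of test functions. -/
noncomputable def testGradients (α : ℝ) : Submodule ℂ L2Field where
  carrier := {w | ∃ η, IsTestFunction η ∧ w =ᵐ[volume] magGrad α η}
  zero_mem' := ⟨fun _ => 0, isTestFunction_zero, by
    filter_upwards [Lp.coeFn_zero (EuclideanSpace ℂ (Fin 2)) 2 (volume : Measure Plane)] with x hx
    rw [hx, magGrad_zero]; rfl⟩
  add_mem' := by
    rintro v w ⟨η, hη, hv⟩ ⟨ξ, hξ, hw⟩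
    refine ⟨_, hη.add hξ, ?_⟩
    filter_upwards [Lp.coeFn_add v w, hv, hw] with x h h1 h2
    rw [h, hη.magGrad_add hξ, Pi.add_apply, h1, h2]
  smul_mem' := by
    rintro c v ⟨η, hη, hv⟩
    refine ⟨_, hη.const_mul c, ?_⟩
    filter_upwards [Lp.coeFn_smul c v, hv] with x h h1
    rw [h, hη.magGrad_const_mul, Pi.smul_apply, h1]

/-- Each test function and component contributes one equation between continuous functionals. In
this form the relation is visibly linear and closed, which is all that the graph below needs. -/
theorem hasWeakMagGrad_iff_forall_clm (α : ℝ) :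
    ∃ S : Set ((L2Field →L[ℂ] ℂ) × (L2 →L[ℂ] ℂ)), ∀ ψ v,
      HasWeakMagGrad α ψ v ↔ ∀ p ∈ S, p.1 v = p.2 ψ := by
  refine ⟨{p | ∃ η, IsTestFunction η ∧ ∃ j, (∀ v : L2Field, ∫ x, η x * v x j = p.1 v) ∧
    ∀ ψ : L2, ∫ x, ψ x * (Complex.I * partialDeriv j η x + (abPotential α x j : ℂ) * η x)
      = p.2 ψ}, fun ψ v => ⟨?_, ?_⟩⟩
  · rintro h ⟨L, M⟩ ⟨η, hη, j, h1, h2⟩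
    rw [← h1, ← h2]
    exact h η hη j
  · intro h η hη j
    obtain ⟨L, hL⟩ := exists_clm_integral_mul_comp (hη.memLp 2) j
    obtain ⟨M, hM⟩ := exists_clm_integral_mul (hη.memLp_dual α j)
    have hM' : ∀ ψ : L2, ∫ x, ψ x * (Complex.I * partialDeriv j η x +
        (abPotential α x j : ℂ) * η x) = M ψ := fun ψ => by
      rw [← hM]; simp only [mul_comm]
    have := h (L, M) ⟨η, hη, j, hL, hM'⟩
    rw [hL, hM', this]

/-- Reflection at the origin, as an isometry of `L²`. -/
noncomputable def reflection : L2 →ₗᵢ[ℂ] L2 :=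
  Lp.compMeasurePreservingₗᵢ ℂ (fun x : Plane => -x) (Measure.measurePreserving_neg volume)

theorem mem_L2even_iff (ψ : L2) : ψ ∈ L2even ↔ reflection ψ = ψ := by
  have h : ∀ᵐ x : Plane, reflection ψ x = ψ (-x) :=
    Lp.coeFn_compMeasurePreserving ψ (Measure.measurePreserving_neg volume)
  constructor
  · intro he
    refine Lp.ext ?_
    filter_upwards [h, he] with x h1 h2
    rw [h1, h2]
  · intro he
    rw [he] at h
    filter_upwards [h] with x h1 using h1.symm

/-- The pairs `(ψ, D_α ψ)` with `ψ` in the domain of the Friedrichs form. -/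
noncomputable def friedrichsGraph (α : ℝ) : Submodule ℂ (L2 × L2Field) where
  carrier := {p | p.1 ∈ L2even ∧ HasWeakMagGrad α p.1 p.2 ∧
    p.2 ∈ (testGradients α).topologicalClosure}
  zero_mem' := by
    obtain ⟨S, hS⟩ := hasWeakMagGrad_iff_forall_clm α
    simp only [mem_ofPred_eq, mem_L2even_iff, hS]
    exact ⟨map_zero _, fun p _ => by simp, zero_mem _⟩
  add_mem' := by
    obtain ⟨S, hS⟩ := hasWeakMagGrad_iff_forall_clm α
    rintro ⟨a, b⟩ ⟨c, d⟩ ⟨h1, h2, h3⟩ ⟨h4, h5, h6⟩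
    simp only [mem_ofPred_eq, mem_L2even_iff, hS, Prod.mk_add_mk] at *
    exact ⟨by rw [map_add, h1, h4], fun p hp => by rw [map_add, map_add, h2 p hp, h5 p hp],
      add_mem h3 h6⟩
  smul_mem' := by
    obtain ⟨S, hS⟩ := hasWeakMagGrad_iff_forall_clm α
    rintro c ⟨a, b⟩ ⟨h1, h2, h3⟩
    simp only [mem_ofPred_eq, mem_L2even_iff, hS, Prod.smul_mk] at *
    exact ⟨by rw [map_smul, h1], fun p hp => by rw [map_smul, map_smul, h2 p hp],
      Submodule.smul_mem _ c h3⟩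

/-- Each of the three defining conditions is closed. This is used twice: to put limits of cut-off
functions into the Friedrichs domain, and to prove that the form is closed. -/
theorem isClosed_friedrichsGraph (α : ℝ) : IsClosed (friedrichsGraph α : Set (L2 × L2Field)) := by
  obtain ⟨S, hS⟩ := hasWeakMagGrad_iff_forall_clm α
  have h1 : IsClosed {p : L2 × L2Field | reflection p.1 = p.1} :=
    isClosed_eq (reflection.continuous.comp continuous_fst) continuous_fst
  have h2 : IsClosed {p : L2 × L2Field | ∀ q ∈ S, q.1 p.2 = q.2 p.1} := by
    simp only [ofPred_forall]
    exact isClosed_biInter fun q _ => isClosed_eq (q.1.continuous.comp continuous_snd)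
      (q.2.continuous.comp continuous_fst)
  have h3 : IsClosed {p : L2 × L2Field | p.2 ∈ (testGradients α).topologicalClosure} :=
    (Submodule.isClosed_topologicalClosure _).preimage continuous_snd
  convert! h1.inter (h2.inter h3) using 1
  ext p
  change (p.1 ∈ L2even ∧ HasWeakMagGrad α p.1 p.2 ∧ _) ↔ _
  rw [mem_L2even_iff, hS]
  rfl

/-- Approximation of `v` by gradients of test functions within every `ε` is membership of `v` in
their `L²` closure. -/
theorem mem_friedrichsDomain_iff {α : ℝ} {ψ : L2} :
    ψ ∈ friedrichsDomain α ↔ ∃ v, (ψ, v) ∈ friedrichsGraph α := by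
  have key : ∀ v : L2Field, v ∈ (testGradients α).topologicalClosure ↔
      ∀ ε : ℝ≥0∞, 0 < ε → ∃ η : Plane → ℂ, IsTestFunction η ∧
      eLpNorm (fun x => magGrad α η x - v x) 2 volume < ε := by
    intro v
    rw [← SetLike.mem_coe, Submodule.topologicalClosure_coe, EMetric.mem_closure_iff]
    have hd : ∀ (w : L2Field) (η : Plane → ℂ), w =ᵐ[volume] magGrad α η →
        edist v w = eLpNorm (fun x => magGrad α η x - v x) 2 volume := by
      intro w η hw
      rw [edist_comm, Lp.edist_def]
      refine eLpNorm_congr_ae ?_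
      filter_upwards [hw] with x hx
      simp [hx]
    constructor
    · intro h ε hε
      obtain ⟨w, ⟨η, hη, hw⟩, hlt⟩ := h ε hε
      exact ⟨η, hη, by rwa [← hd w η hw]⟩
    · intro h ε hε
      obtain ⟨η, hη, hlt⟩ := h ε hε
      have hw := (hη.memLp_magGrad α).coeFn_toLp
      exact ⟨(hη.memLp_magGrad α).toLp _, ⟨η, hη, hw⟩, by rwa [hd _ η hw]⟩
  constructor
  · rintro ⟨h, v, hv, ha⟩
    exact ⟨v, h, hv, (key v).2 ha⟩
  · rintro ⟨v, h, hv, ha⟩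
    exact ⟨h, v, hv, (key v).1 ha⟩

theorem integral_norm_sq_eq {E : Type*} [NormedAddCommGroup E] [InnerProductSpace ℂ E]
    (v : Lp E 2 (volume : Measure Plane)) : ∫ x, ‖v x‖ ^ 2 = ‖v‖ ^ 2 := by
  rw [← inner_self_eq_norm_sq (𝕜 := ℂ), L2.inner_def, ← integral_re (L2.integrable_inner v v)]
  refine integral_congr_ae (Eventually.of_forall fun x => ?_)
  exact (inner_self_eq_norm_sq (𝕜 := ℂ) (v x)).symm

/-- Dominated convergence in `L²`. -/
theorem tendsto_toLp_of_dominated {E : Type*} [NormedAddCommGroup E] [InnerProductSpace ℂ E]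
    {F : ℕ → Plane → E} {f : Plane → E} {bound : Plane → ℝ}
    (hF : ∀ n, MemLp (F n) 2 volume) (hf : MemLp f 2 volume) (hb : MemLp bound 2 volume)
    (hle : ∀ n, ∀ᵐ x, ‖F n x‖ ≤ bound x)
    (hlim : ∀ᵐ x, Tendsto (fun n => F n x) atTop (𝓝 (f x))) :
    Tendsto (fun n => (hF n).toLp (F n)) atTop (𝓝 (hf.toLp f)) := by
  rw [tendsto_iff_norm_sub_tendsto_zero]
  have key : Tendsto (fun n => ‖(hF n).toLp (F n) - hf.toLp f‖ ^ 2) atTop (𝓝 0) := by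
    have e : ∀ n, ‖(hF n).toLp (F n) - hf.toLp f‖ ^ 2 = ∫ x, ‖F n x - f x‖ ^ 2 := fun n => by
      rw [← MemLp.toLp_sub, ← integral_norm_sq_eq]
      refine integral_congr_ae ?_
      filter_upwards [((hF n).sub hf).coeFn_toLp] with x hx
      rw [hx, Pi.sub_apply]
    simp only [e]
    have hle' : ∀ᵐ x, ∀ n, ‖F n x‖ ≤ bound x := ae_all_iff.2 hle
    have h0 : (0 : ℝ) = ∫ _ : Plane, (0 : ℝ) := by simp
    rw [h0]
    refine tendsto_integral_of_dominated_convergence (fun x => (2 * bound x) ^ 2)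
      (fun n => (((hF n).sub hf).aestronglyMeasurable.norm).pow 2)
      ((hb.const_mul 2).integrable_sq) (fun n => ?_) ?_
    · filter_upwards [hle', hlim] with x hx hl
      have hfx : ‖f x‖ ≤ bound x := le_of_tendsto hl.norm (Eventually.of_forall hx)
      rw [Real.norm_of_nonneg (by positivity)]
      exact pow_le_pow_left₀ (norm_nonneg _)
        ((norm_sub_le _ _).trans (by linarith [hx n])) 2
    · filter_upwards [hlim] with x hl
      simpa using ((hl.sub_const (f x)).norm.pow 2)
  have := (Real.continuous_sqrt.tendsto 0).comp key
  simpa [Function.comp_def, Real.sqrt_sq] using this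

theorem HasWeakMagGrad.weakMagGrad_eq {α : ℝ} {ψ : L2} {v : L2Field}
    (h : HasWeakMagGrad α ψ v) : weakMagGrad α ψ = v := by
  have he : ∃ v, HasWeakMagGrad α ψ v := ⟨v, h⟩
  rw [weakMagGrad, dif_pos he]
  exact he.choose_spec.unique h

theorem HasWeakMagGrad.magForm_eq {α : ℝ} {ψ : L2} {v : L2Field}
    (h : HasWeakMagGrad α ψ v) : magForm α ψ = ‖v‖ ^ 2 := by
  rw [magForm, h.weakMagGrad_eq, integral_norm_sq_eq]

/-! ### Integration by parts for test functions -/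

theorem IsTestFunction.integral_partialDeriv_mul {η ξ : Plane → ℂ} (hη : IsTestFunction η)
    (hξ : IsTestFunction ξ) (j : Fin 2) :
    ∫ x, η x * _root_.partialDeriv j ξ x = - ∫ x, _root_.partialDeriv j η x * ξ x := by
  have hI : ∀ {a b : Plane → ℂ}, IsTestFunction a → IsTestFunction b →
      Integrable (fun x => a x * b x) := fun {a b} ha hb =>
    (ha.1.continuous.mul hb.1.continuous).integrable_of_hasCompactSupport ha.2.1.mul_right
  exact integral_mul_fderiv_eq_neg_fderiv_mul_of_integrable
    (hI (hη.partialDeriv j) hξ) (hI hη (hξ.partialDeriv j)) (hI hη hξ)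
    (fun x _ => hη.1.differentiable (by simp) x) (fun x _ => hξ.1.differentiable (by simp) x)

theorem IsTestFunction.hasWeakMagGrad {η : Plane → ℂ} (hη : IsTestFunction η) {α : ℝ}
    {ψ : L2} {v : L2Field} (hψ : ψ =ᵐ[volume] η) (hv : v =ᵐ[volume] magGrad α η) :
    HasWeakMagGrad α ψ v := by
  intro ξ hξ j
  have hI : ∀ {a b : Plane → ℂ}, IsTestFunction a → IsTestFunction b →
      Integrable (fun x => a x * b x) := fun {a b} ha hb =>
    (ha.1.continuous.mul hb.1.continuous).integrable_of_hasCompactSupport ha.2.1.mul_right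
  have e1 : ∫ x, ξ x * v x j = ∫ x, (-Complex.I * (ξ x * _root_.partialDeriv j η x) +
      ξ x * ((abPotential α x j : ℂ) * η x)) := by
    refine integral_congr_ae ?_
    filter_upwards [hv] with x hx
    rw [hx]
    simp only [magGrad]
    ring
  have e2 : ∫ x, ψ x * (Complex.I * _root_.partialDeriv j ξ x + (abPotential α x j : ℂ) * ξ x) =
      ∫ x, (Complex.I * (_root_.partialDeriv j ξ x * η x) +
        ξ x * ((abPotential α x j : ℂ) * η x)) := by
    refine integral_congr_ae ?_
    filter_upwards [hψ] with x hx
    rw [hx]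
    ring
  rw [e1, e2, integral_add ((hI hξ (hη.partialDeriv j)).const_mul _)
    (hI hξ (hη.potential_mul α j)), integral_add ((hI (hξ.partialDeriv j) hη).const_mul _)
    (hI hξ (hη.potential_mul α j)), integral_const_mul, integral_const_mul,
    hξ.integral_partialDeriv_mul hη]
  ring

/-! ### Radial profiles -/

/-- Smooth functions with compact support in `(0, ∞)`. -/
def IsProfile (a : ℝ → ℂ) : Prop :=
  ContDiff ℝ ∞ a ∧ ∃ lo hi : ℝ, 0 < lo ∧ ∀ s, a s ≠ 0 → s ∈ Icc lo hi

theorem IsProfile.tsupport_subset {a : ℝ → ℂ} (ha : IsProfile a) : tsupport a ⊆ Ioi 0 := by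
  obtain ⟨-, lo, hi, h0, h⟩ := ha
  exact (closure_minimal (fun s hs => h s hs) isClosed_Icc).trans fun s hs => h0.trans_le hs.1

theorem IsProfile.eq_zero {a : ℝ → ℂ} (ha : IsProfile a) {s : ℝ} (hs : s ≤ 0) : a s = 0 := by
  by_contra h
  exact absurd (ha.tsupport_subset (subset_tsupport a h)) (not_lt.2 hs)

theorem IsProfile.mul_contDiffOn {a f : ℝ → ℂ} (ha : IsProfile a)
    (hf : ContDiffOn ℝ ∞ f (Ioi 0)) : IsProfile (fun s => a s * f s) := by
  refine ⟨contDiff_of_contDiffAt_tsupport fun s hs => ?_, ?_⟩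
  · have hs0 : s ∈ Ioi (0 : ℝ) := ha.tsupport_subset (tsupport_mul_subset_left hs)
    exact ha.1.contDiffAt.mul (hf.contDiffAt (Ioi_mem_nhds hs0))
  · obtain ⟨-, lo, hi, h0, h⟩ := ha
    exact ⟨lo, hi, h0, fun s hs => h s (left_ne_zero_of_mul hs)⟩

theorem IsProfile.deriv {a : ℝ → ℂ} (ha : IsProfile a) : IsProfile (deriv a) := by
  refine ⟨(contDiff_infty_iff_deriv.1 ha.1).2, ?_⟩
  obtain ⟨-, lo, hi, h0, h⟩ := ha
  refine ⟨lo, hi, h0, fun s hs => ?_⟩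
  exact (closure_minimal (fun s hs => h s hs) isClosed_Icc) (support_deriv_subset hs)

/-- Profiles are functions of `s = |x|²` rather than of `|x|`, so that composition with a smooth map
suffices. -/
theorem IsProfile.testFunction {a : ℝ → ℂ} (ha : IsProfile a) {p : Plane → ℂ}
    (hp : ContDiff ℝ ∞ p) : IsTestFunction (fun x => a (‖x‖ ^ 2) * p x) := by
  have hc : ContDiff ℝ ∞ (fun x : Plane => a (‖x‖ ^ 2)) := ha.1.comp (contDiff_norm_sq ℝ)
  obtain ⟨-, lo, hi, h0, h⟩ := ha
  have hsub : ∀ x : Plane, a (‖x‖ ^ 2) * p x ≠ 0 → ‖x‖ ^ 2 ∈ Icc lo hi := fun x hx =>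
    h _ (left_ne_zero_of_mul hx)
  have hcl : tsupport (fun x : Plane => a (‖x‖ ^ 2) * p x) ⊆ {x | ‖x‖ ^ 2 ∈ Icc lo hi} :=
    closure_minimal hsub (isClosed_Icc.preimage (by fun_prop))
  refine ⟨hc.mul hp, ?_, fun x hx => ?_⟩
  · refine HasCompactSupport.intro (isCompact_closedBall (0 : Plane) (Real.sqrt hi)) fun x hx => ?_
    by_contra hne
    refine hx ?_
    rw [mem_closedBall_zero_iff]
    exact Real.le_sqrt_of_sq_le (hsub x hne).2
  · rintro rfl
    have := (hcl hx).1
    simp at this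
    linarith

theorem contDiff_coord (j : Fin 2) : ContDiff ℝ ∞ (fun x : Plane => (x j : ℂ)) :=
  Complex.ofRealCLM.contDiff.comp (EuclideanSpace.proj (𝕜 := ℝ) j : Plane →L[ℝ] ℝ).contDiff

theorem partialDeriv_radial_mul {a : ℝ → ℂ} {p : Plane → ℂ} {x : Plane}
    (ha : DifferentiableAt ℝ a (‖x‖ ^ 2)) (hp : DifferentiableAt ℝ p x) (j : Fin 2) :
    partialDeriv j (fun x => a (‖x‖ ^ 2) * p x) x =
      2 * x j * deriv a (‖x‖ ^ 2) * p x + a (‖x‖ ^ 2) * partialDeriv j p x := by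
  have h1 : HasFDerivAt (fun x : Plane => ‖x‖ ^ 2) (2 • innerSL ℝ x) x :=
    (hasStrictFDerivAt_norm_sq x).hasFDerivAt
  have h0 : HasFDerivAt (fun x : Plane => a (‖x‖ ^ 2)) _ x :=
    ha.hasDerivAt.hasFDerivAt.comp x h1
  have h2 := h0.mul hp.hasFDerivAt
  have h3 : inner ℝ x (EuclideanSpace.single j (1 : ℝ)) = x j := by
    simp [EuclideanSpace.inner_single_right]
  simp only [partialDeriv]
  erw [h2.fderiv]
  simp [h3, Complex.real_smul]
  ring

theorem partialDeriv_radial {a : ℝ → ℂ} {x : Plane}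
    (ha : DifferentiableAt ℝ a (‖x‖ ^ 2)) (j : Fin 2) :
    partialDeriv j (fun x => a (‖x‖ ^ 2)) x = 2 * x j * deriv a (‖x‖ ^ 2) := by
  have := partialDeriv_radial_mul (p := fun _ => 1) ha (differentiableAt_const _) j
  simpa [partialDeriv] using this

theorem partialDeriv_coord (i j : Fin 2) (x : Plane) :
    partialDeriv j (fun x : Plane => (x i : ℂ)) x = if i = j then 1 else 0 := by
  have h : HasFDerivAt (fun x : Plane => (x i : ℂ))
      (Complex.ofRealCLM.comp (EuclideanSpace.proj (𝕜 := ℝ) i : Plane →L[ℝ] ℝ)) x :=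
    (Complex.ofRealCLM.comp (EuclideanSpace.proj (𝕜 := ℝ) i : Plane →L[ℝ] ℝ)).hasFDerivAt
  rw [partialDeriv, h.fderiv]
  simp only [ContinuousLinearMap.comp_apply]
  by_cases hij : i = j <;> simp [hij]

theorem norm_sq_plane (x : Plane) : ‖x‖ ^ 2 = x 0 ^ 2 + x 1 ^ 2 := by
  simp [EuclideanSpace.norm_sq_eq]

/-- The rotated vector `(x, y)^⊥ = (-y, x)`. -/
noncomputable def perp (x : Plane) : Plane := !₂[-x 1, x 0]

@[simp] theorem perp_zero (x : Plane) : perp x 0 = -x 1 := rfl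
@[simp] theorem perp_one (x : Plane) : perp x 1 = x 0 := rfl

theorem norm_perp (x : Plane) : ‖perp x‖ = ‖x‖ := by
  rw [← sq_eq_sq₀ (norm_nonneg _) (norm_nonneg _), norm_sq_plane, norm_sq_plane]
  simp
  ring

/-- The field `a(|x|²) x + b(|x|²) x^⊥`. -/
noncomputable def radialField (a b : ℝ → ℂ) (x : Plane) : EuclideanSpace ℂ (Fin 2) :=
  WithLp.toLp 2 fun j => a (‖x‖ ^ 2) * x j + b (‖x‖ ^ 2) * perp x j

theorem norm_radialField_le (a b : ℝ → ℂ) (x : Plane) :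
    ‖radialField a b x‖ ≤ ‖a (‖x‖ ^ 2)‖ * ‖x‖ + ‖b (‖x‖ ^ 2)‖ * ‖x‖ := by
  let E : Plane → EuclideanSpace ℂ (Fin 2) := fun y => WithLp.toLp 2 fun j => (y j : ℂ)
  have hE : ∀ y, ‖E y‖ = ‖y‖ := fun y => by
    simp [E, EuclideanSpace.norm_eq]
  have : radialField a b x = a (‖x‖ ^ 2) • E x + b (‖x‖ ^ 2) • E (perp x) := by
    ext j
    simp [radialField, E]
  rw [this]
  refine (norm_add_le _ _).trans (le_of_eq ?_)
  rw [norm_smul, norm_smul, hE, hE, norm_perp]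

/-- A radial function has a magnetic gradient of the form `a x + b x^⊥`. -/
theorem magGrad_radial {a : ℝ → ℂ} (α : ℝ) {x : Plane} (ha : DifferentiableAt ℝ a (‖x‖ ^ 2)) :
    magGrad α (fun x => a (‖x‖ ^ 2)) x =
      radialField (fun s => -Complex.I * (2 * deriv a s)) (fun s => α / s * a s) x := by
  ext j
  simp only [magGrad, radialField, partialDeriv_radial ha, abPotential, perp]
  push_cast
  ring

theorem isTestFunction_radialField {a b : ℝ → ℂ} (ha : IsProfile a) (hb : IsProfile b)
    (j : Fin 2) : IsTestFunction (fun x => radialField a b x j) := by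
  have hp : ContDiff ℝ ∞ fun x : Plane => ((perp x j : ℝ) : ℂ) := by
    fin_cases j
    · simpa using (contDiff_coord 1).neg
    · simpa using contDiff_coord 0
  exact (ha.testFunction (contDiff_coord j)).add (hb.testFunction hp)

/-- Integration by parts against fields `a(|x|²) x + b(|x|²) x^⊥`. -/
theorem HasWeakMagGrad.integral_radialField {α : ℝ} {ψ : L2} {v : L2Field}
    (h : HasWeakMagGrad α ψ v) {a b : ℝ → ℂ} (ha : IsProfile a) (hb : IsProfile b) :
    ∫ x, ∑ j, radialField a b x j * v x j =
      ∫ x, ψ x * (Complex.I * (2 * a (‖x‖ ^ 2) + 2 * (‖x‖ ^ 2 : ℝ) * deriv a (‖x‖ ^ 2)) +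
        α * b (‖x‖ ^ 2)) := by
  have hT := isTestFunction_radialField ha hb
  have hI : ∀ j, Integrable (fun x => radialField a b x j * v x j) := fun j => by
    have h1 : MemLp (fun x => v x j) 2 volume :=
      (memLp_congr_ae (coeFn_fieldComp j v)).1 (Lp.memLp _)
    exact ((hT j).memLp 2).integrable_mul h1
  have hJ : ∀ j, Integrable (fun x => ψ x * (Complex.I * partialDeriv j
      (fun x => radialField a b x j) x + (abPotential α x j : ℂ) * radialField a b x j)) :=
    fun j => (Lp.memLp ψ).integrable_mul ((hT j).memLp_dual α j)
  rw [integral_finsetSum _ fun j _ => hI j, Finset.sum_congr rfl fun j _ => h _ (hT j) j,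
    ← integral_finsetSum _ fun j _ => hJ j]
  refine integral_congr_ae (Eventually.of_forall fun x => ?_)
  have hda : DifferentiableAt ℝ a (‖x‖ ^ 2) := ha.1.differentiable (by simp) _
  have hdb : DifferentiableAt ℝ b (‖x‖ ^ 2) := hb.1.differentiable (by simp) _
  have hdc : ∀ j, DifferentiableAt ℝ (fun x : Plane => (x j : ℂ)) x := fun j =>
    (contDiff_coord j).differentiable (by simp) x
  have e : ∀ j k : Fin 2, ∀ σ : ℂ, partialDeriv j (fun x => a (‖x‖ ^ 2) * x j +
      b (‖x‖ ^ 2) * (σ * x k)) x = 2 * x j * deriv a (‖x‖ ^ 2) * x j + a (‖x‖ ^ 2) +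
      (2 * x j * deriv b (‖x‖ ^ 2) * (σ * x k) +
        b (‖x‖ ^ 2) * (σ * if k = j then 1 else 0)) := by
    intro j k σ
    have e1 := partialDeriv_radial_mul hda (hdc j) j
    have e2 := partialDeriv_radial_mul hdb ((hdc k).const_mul σ) j
    have e3 : partialDeriv j (fun x : Plane => σ * (x k : ℂ)) x =
        σ * if k = j then 1 else 0 := by
      rw [← partialDeriv_coord k j x, partialDeriv, fderiv_const_mul (hdc k)]
      rfl
    have e4 : partialDeriv j (fun x : Plane => a (‖x‖ ^ 2) * x j +
        b (‖x‖ ^ 2) * (σ * x k)) x = partialDeriv j (fun x : Plane => a (‖x‖ ^ 2) * x j) x +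
        partialDeriv j (fun x : Plane => b (‖x‖ ^ 2) * (σ * x k)) x := by
      simp only [partialDeriv]
      rw [fderiv_fun_add]
      · rfl
      · exact (ha.testFunction (contDiff_coord j)).1.differentiable (by simp) x
      · exact (hb.testFunction (contDiff_const.mul (contDiff_coord k))).1.differentiable
          (by simp) x
    rw [e4, e1, e2, e3, partialDeriv_coord]
    simp
  have e0 := e 0 1 (-1)
  have e1 := e 1 0 1
  have f0 : (fun x => radialField a b x 0) =
      fun x => a (‖x‖ ^ 2) * x 0 + b (‖x‖ ^ 2) * (-1 * x 1) := by
    ext x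
    simp [radialField]
  have f1 : (fun x => radialField a b x 1) =
      fun x => a (‖x‖ ^ 2) * x 1 + b (‖x‖ ^ 2) * (1 * x 0) := by
    ext x
    simp [radialField]
  rw [← f0] at e0
  rw [← f1] at e1
  beta_reduce
  rw [Fin.sum_univ_two, e0, e1]
  by_cases hx : x = 0
  -- At the origin `abPotential` takes the value 0 through division by zero, which agrees with `b 0
  -- = 0`.
  · subst hx
    simp [radialField, abPotential, hb.eq_zero le_rfl]
    ring
  have hn : ((x 0 : ℂ) ^ 2 + (x 1 : ℂ) ^ 2) ≠ 0 := by
    have : (‖x‖ : ℝ) ^ 2 ≠ 0 := by simpa using hx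
    rw [norm_sq_plane] at this
    exact_mod_cast this
  simp only [radialField, abPotential, norm_sq_plane, perp]
  push_cast
  simp
  field_simp
  ring

/-! ### Cutoffs -/

/-- Cutoff functions on `(0, ∞)` whose logarithmic derivatives tend to `0`. -/
theorem exists_cutoff : ∃ (χ : ℕ → ℝ → ℝ) (C : ℝ), 0 ≤ C ∧
    (∀ n, IsProfile (fun s => (χ n s : ℂ))) ∧ (∀ n, Differentiable ℝ (χ n)) ∧
    (∀ n s, 0 ≤ χ n s) ∧ (∀ n s, χ n s ≤ 1) ∧
    (∀ n s, 0 < s → |s * deriv (χ n) s| ≤ C) ∧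
    (∀ s, 0 < s → Tendsto (fun n => χ n s) atTop (𝓝 1)) ∧
    (∀ s, 0 < s → Tendsto (fun n => s * deriv (χ n) s) atTop (𝓝 0)) := by
  let θ : ContDiffBump (0 : ℝ) := ⟨1, 2, one_pos, one_lt_two⟩
  have hθ : ContDiff ℝ ∞ θ := θ.contDiff
  have hθs : ∀ y, θ y ≠ 0 → y ∈ Ioo (-2 : ℝ) 2 := fun y hy => by
    have : y ∈ Function.support θ := hy
    rw [θ.support_eq, Real.ball_eq_Ioo] at this
    simpa [θ] using this
  obtain ⟨C, hC⟩ : ∃ C, ∀ y, ‖deriv θ y‖ ≤ C :=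
    (hθ.continuous_deriv (by simp)).bounded_above_of_compact_support θ.hasCompactSupport.deriv
  have hC0 : 0 ≤ C := (norm_nonneg _).trans (hC 0)
  -- Cutting off in the variable `log s` makes `s χ'` of size `1 / (n + 1)`; a cutoff at one scale
  -- in `s` would only keep it bounded.
  let χ : ℕ → ℝ → ℝ := fun n s => if 0 < s then θ (Real.log s / (n + 1)) else 0
  have hpos : ∀ (n : ℕ) (s : ℝ), 0 < s → χ n =ᶠ[𝓝 s] fun s => θ (Real.log s / (n + 1)) := by
    intro n s hs
    filter_upwards [Ioi_mem_nhds hs] with t ht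
    exact if_pos ht
  have hsupp : ∀ (n : ℕ) (s : ℝ), χ n s ≠ 0 →
      s ∈ Icc (Real.exp (-2 * (n + 1))) (Real.exp (2 * (n + 1))) := by
    intro n s hs
    by_cases h0 : 0 < s
    · simp only [χ, if_pos h0] at hs
      have hn : (0 : ℝ) < n + 1 := by positivity
      obtain ⟨h1, h2⟩ := hθs _ hs
      rw [lt_div_iff₀ hn] at h1
      rw [div_lt_iff₀ hn] at h2
      exact ⟨(Real.le_log_iff_exp_le h0).1 h1.le, (Real.log_le_iff_le_exp h0).1 h2.le⟩
    · simp [χ, h0] at hs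
  have hsm : ∀ n, ContDiff ℝ ∞ (χ n) := by
    intro n
    refine contDiff_of_contDiffAt_tsupport fun s hs => ?_
    have hs0 : 0 < s := (Real.exp_pos _).trans_le
      (closure_minimal (fun s hs => hsupp n s hs) isClosed_Icc hs).1
    refine ContDiffAt.congr_of_eventuallyEq ?_ (hpos n s hs0)
    exact hθ.contDiffAt.comp s ((Real.contDiffAt_log.2 hs0.ne').div_const _)
  have hder : ∀ (n : ℕ) (s : ℝ), 0 < s →
      s * deriv (χ n) s = deriv θ (Real.log s / (n + 1)) / (n + 1) := by
    intro n s hs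
    have h1 : HasDerivAt (fun s => θ (Real.log s / (n + 1)))
        (deriv θ (Real.log s / (n + 1)) * (s⁻¹ / (n + 1))) s :=
      ((hθ.differentiable (by simp)) _).hasDerivAt.comp s
        ((Real.hasDerivAt_log hs.ne').div_const _)
    rw [(hpos n s hs).deriv_eq, h1.deriv]
    field_simp
  have hbd : ∀ (n : ℕ) (s : ℝ), 0 < s → |s * deriv (χ n) s| ≤ C / (n + 1) := by
    intro n s hs
    have hn : (0 : ℝ) < n + 1 := by positivity
    rw [hder n s hs, abs_div, abs_of_pos hn]
    gcongr
    exact hC _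
  have hlim : Tendsto (fun n : ℕ => (n : ℝ) + 1) atTop atTop :=
    tendsto_atTop_add_const_right _ _ tendsto_natCast_atTop_atTop
  refine ⟨χ, C, hC0, fun n => ⟨Complex.ofRealCLM.contDiff.comp (hsm n), _, _,
    Real.exp_pos (-2 * (n + 1)), fun s hs => hsupp n s fun h => hs (by simp [h])⟩,
    fun n => (hsm n).differentiable (by simp), fun n s => ?_, fun n s => ?_, fun n s hs => ?_,
    fun s hs => ?_, fun s hs => ?_⟩
  · by_cases h : 0 < s
    · simp only [χ, if_pos h]; exact θ.nonneg
    · simp [χ, h]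
  · by_cases h : 0 < s
    · simp only [χ, if_pos h]; exact θ.le_one
    · simp [χ, h]
  · refine (hbd n s hs).trans (div_le_self hC0 ?_)
    linarith [n.cast_nonneg (α := ℝ)]
  · refine tendsto_const_nhds.congr' ?_
    filter_upwards [hlim.eventually_ge_atTop |Real.log s|] with n hn
    simp only [χ, if_pos hs]
    refine (θ.one_of_mem_closedBall ?_).symm
    have hn0 : (0 : ℝ) < n + 1 := by positivity
    rw [mem_closedBall_zero_iff, Real.norm_eq_abs, abs_div, abs_of_pos hn0]
    exact (div_le_one hn0).2 hn
  · refine squeeze_zero_norm (fun n => hbd n s hs) ?_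
    exact tendsto_const_nhds.div_atTop hlim

/-! ### Radial functions -/

/-- The magnetic gradient of the radial function `f(|x|²)`. -/
noncomputable def radialGrad (α : ℝ) (f : ℝ → ℝ) : Plane → EuclideanSpace ℂ (Fin 2) :=
  radialField (fun s => -Complex.I * (2 * (deriv f s : ℝ))) (fun s => α / s * f s)

/-- The two terms are the radial and the angular part of the gradient. Finite energy of a radial
function is therefore expressed below by `|x| f'(|x|²)` and `f(|x|²) / |x|` being in `L²`. -/
theorem norm_radialGrad_le (α : ℝ) (f : ℝ → ℝ) (x : Plane) :
    ‖radialGrad α f x‖ ≤ 2 * |‖x‖ * deriv f (‖x‖ ^ 2)| + |α| * |f (‖x‖ ^ 2) / ‖x‖| := by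
  refine (norm_radialField_le _ _ x).trans (le_of_eq ?_)
  rcases eq_or_ne x 0 with rfl | hx
  · simp
  have : ‖x‖ ≠ 0 := norm_ne_zero_iff.2 hx
  simp [abs_mul, abs_div]
  field_simp

theorem ae_ne_zero_plane : ∀ᵐ x : Plane, x ≠ 0 := by
  simpa using (measure_eq_zero_iff_ae_notMem.1
      (measure_singleton (μ := (volume : Measure Plane)) 0))

theorem deriv_ofReal_comp {f : ℝ → ℝ} {s : ℝ} (hf : DifferentiableAt ℝ f s) :
    deriv (fun s => (f s : ℂ)) s = (deriv f s : ℝ) :=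
  hf.hasDerivAt.ofReal_comp.deriv

theorem aestronglyMeasurable_comp_norm_sq {f : ℝ → ℝ} (hf : ContinuousOn f (Ioi 0)) :
    AEStronglyMeasurable (fun x : Plane => f (‖x‖ ^ 2)) volume := by
  have h1 : ContinuousOn (fun x : Plane => f (‖x‖ ^ 2)) {0}ᶜ := by
    refine hf.comp (by fun_prop) fun x hx => ?_
    have : x ≠ 0 := hx
    exact pow_pos (norm_pos_iff.2 this) 2
  have h2 := h1.aestronglyMeasurable (μ := (volume : Measure Plane))
    (measurableSet_singleton (0 : Plane)).compl
  rwa [restrict_compl_singleton] at h2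

theorem contDiffOn_deriv_Ioi {f : ℝ → ℝ} (hf : ContDiffOn ℝ ∞ f (Ioi 0)) :
    ContDiffOn ℝ ∞ (deriv f) (Ioi 0) :=
  ((contDiffOn_infty_iff_deriv_of_isOpen isOpen_Ioi).1 hf).2

theorem aestronglyMeasurable_radialField {a b : ℝ → ℂ} (ha : ContinuousOn a (Ioi 0))
    (hb : ContinuousOn b (Ioi 0)) : AEStronglyMeasurable (radialField a b) volume := by
  have h0 : ∀ x : Plane, x ∈ ({0}ᶜ : Set Plane) → ‖x‖ ^ 2 ∈ Ioi (0 : ℝ) := fun x hx =>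
    pow_pos (norm_pos_iff.2 hx) 2
  have h1 : ContinuousOn (radialField a b) {0}ᶜ := by
    refine (PiLp.continuous_toLp 2 _).comp_continuousOn (continuousOn_pi.2 fun j => ?_)
    have hp : Continuous fun x : Plane => ((perp x j : ℝ) : ℂ) := by
      fin_cases j
      · simpa using (contDiff_coord 1).neg.continuous
      · simpa using (contDiff_coord 0).continuous
    exact ((ha.comp (by fun_prop) h0).mul (contDiff_coord j).continuous.continuousOn).add
      ((hb.comp (by fun_prop) h0).mul hp.continuousOn)
  have h2 := h1.aestronglyMeasurable (μ := (volume : Measure Plane))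
    (measurableSet_singleton (0 : Plane)).compl
  rwa [restrict_compl_singleton] at h2

section Radial

variable {α : ℝ} {f : ℝ → ℝ}

theorem memLp_radialGrad (hf : ContDiffOn ℝ ∞ f (Ioi 0))
    (hd : MemLp (fun x : Plane => ‖x‖ * deriv f (‖x‖ ^ 2)) 2 volume)
    (hr : MemLp (fun x : Plane => f (‖x‖ ^ 2) / ‖x‖) 2 volume) :
    MemLp (radialGrad α f) 2 volume := by
  refine MemLp.mono' ((hd.norm.const_mul 2).add (hr.norm.const_mul |α|)) ?_
    (Eventually.of_forall fun x => norm_radialGrad_le α f x)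
  refine aestronglyMeasurable_radialField ?_ ?_
  · have := (contDiffOn_deriv_Ioi hf).continuousOn
    fun_prop
  · have := hf.continuousOn
    refine ContinuousOn.mul (continuousOn_const.div (by fun_prop) fun s hs => ?_) (by fun_prop)
    have : s ≠ 0 := ne_of_gt hs
    exact_mod_cast this

/-- Radial functions with finite energy belong to the Friedrichs domain. -/
theorem toLp_radial_mem_friedrichsGraph (hf : ContDiffOn ℝ ∞ f (Ioi 0))
    (hg : MemLp (fun x : Plane => (f (‖x‖ ^ 2) : ℂ)) 2 volume)
    (hd : MemLp (fun x : Plane => ‖x‖ * deriv f (‖x‖ ^ 2)) 2 volume)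
    (hr : MemLp (fun x : Plane => f (‖x‖ ^ 2) / ‖x‖) 2 volume) :
    (hg.toLp _, (memLp_radialGrad (α := α) hf hd hr).toLp _) ∈ friedrichsGraph α := by
  obtain ⟨χ, C, hC, hχ, hχd, hχ0, hχ1, hχC, hχl, hχl'⟩ := exists_cutoff
  have hfd : ∀ {s : ℝ}, 0 < s → DifferentiableAt ℝ f s := fun {s} hs =>
    (hf.contDiffAt (Ioi_mem_nhds hs)).differentiableAt (by simp)
  have hf' : ContDiffOn ℝ ∞ (fun s => (f s : ℂ)) (Ioi 0) :=
    Complex.ofRealCLM.contDiff.comp_contDiffOn hf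
  let u : ℕ → ℝ → ℝ := fun n s => χ n s * f s
  have hu : ∀ n, IsProfile (fun s => (u n s : ℂ)) := fun n => by
    simpa [u] using (hχ n).mul_contDiffOn hf'
  have hud : ∀ n {s : ℝ}, 0 < s → deriv (u n) s = deriv (χ n) s * f s + χ n s * deriv f s :=
    fun n {s} hs => deriv_fun_mul (hχd n s) (hfd hs)
  have hη : ∀ n, IsTestFunction (fun x : Plane => (u n (‖x‖ ^ 2) : ℂ)) := fun n => by
    simpa using (hu n).testFunction (p := fun _ => 1) contDiff_const
  have hgrad : ∀ n, ∀ x : Plane, x ≠ 0 → magGrad α (fun x : Plane => (u n (‖x‖ ^ 2) : ℂ)) x =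
      radialGrad α (u n) x := by
    intro n x hx
    have hs : 0 < ‖x‖ ^ 2 := pow_pos (norm_pos_iff.2 hx) 2
    have h1 : DifferentiableAt ℝ (u n) (‖x‖ ^ 2) := (hχd n _).mul (hfd hs)
    have := magGrad_radial (a := fun s => (u n s : ℂ)) α (x := x)
      ((hu n).1.differentiable (by simp) _)
    rw [this]
    ext j
    simp only [radialGrad, radialField, deriv_ofReal_comp h1]
  have hM : ∀ n, MemLp (fun x : Plane => (u n (‖x‖ ^ 2) : ℂ)) 2 volume := fun n => (hη n).memLp 2
  have hMG : ∀ n, MemLp (magGrad α fun x : Plane => (u n (‖x‖ ^ 2) : ℂ)) 2 volume := fun n =>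
    (hη n).memLp_magGrad α
  have hmem : ∀ n, (hM n).toLp _ ∈ L2even := by
    intro n
    have h := (hM n).coeFn_toLp
    have h' := (Measure.measurePreserving_neg (volume : Measure Plane)).quasiMeasurePreserving.ae h
    filter_upwards [h, h'] with x hx hx'
    rw [hx, hx', norm_neg]
  have hseq : ∀ n, ((hM n).toLp _, (hMG n).toLp _) ∈ friedrichsGraph α := fun n => by
    refine ⟨hmem n, (hη n).hasWeakMagGrad (hM n).coeFn_toLp (hMG n).coeFn_toLp, ?_⟩
    exact Submodule.le_topologicalClosure _ ⟨_, hη n, (hMG n).coeFn_toLp⟩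
  -- The cut-off functions `χ_n f` are test functions, and they and their gradients converge in `L²`
  -- by dominated convergence.
  refine (isClosed_friedrichsGraph α).mem_of_tendsto (b := atTop) ?_
    (Eventually.of_forall hseq)
  refine Tendsto.prodMk_nhds ?_ ?_
  · refine tendsto_toLp_of_dominated hM hg hg.norm (fun n => Eventually.of_forall fun x => ?_) ?_
    · simp only [u, Complex.ofReal_mul, norm_mul, Complex.norm_real, Real.norm_eq_abs,
        abs_of_nonneg (hχ0 n _)]
      exact mul_le_of_le_one_left (abs_nonneg _) (hχ1 n _)
    · filter_upwards [ae_ne_zero_plane] with x hx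
      have hs : 0 < ‖x‖ ^ 2 := pow_pos (norm_pos_iff.2 hx) 2
      have := (hχl _ hs).mul_const (f (‖x‖ ^ 2))
      rw [one_mul] at this
      exact (Complex.continuous_ofReal.tendsto _).comp this
  · refine tendsto_toLp_of_dominated hMG (memLp_radialGrad hf hd hr)
      (((hd.norm.const_mul 2).add (hr.norm.const_mul (2 * C))).add (hr.norm.const_mul |α|))
      (fun n => ?_) ?_
    · filter_upwards [ae_ne_zero_plane] with x hx
      have hx' : 0 < ‖x‖ := norm_pos_iff.2 hx
      have hs : 0 < ‖x‖ ^ 2 := pow_pos hx' 2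
      rw [hgrad n x hx]
      refine (norm_radialGrad_le α _ x).trans ?_
      simp only [Pi.add_apply, Real.norm_eq_abs]
      have e1 : |‖x‖ * deriv (u n) (‖x‖ ^ 2)| ≤
          |‖x‖ * deriv f (‖x‖ ^ 2)| + C * |f (‖x‖ ^ 2) / ‖x‖| := by
        -- The derivative of the cutoff enters only through `s χ_n'`, paired with the
        -- square-integrable `f / |x|`.
        have : ‖x‖ * deriv (u n) (‖x‖ ^ 2) = χ n (‖x‖ ^ 2) * (‖x‖ * deriv f (‖x‖ ^ 2)) +
            (‖x‖ ^ 2 * deriv (χ n) (‖x‖ ^ 2)) * (f (‖x‖ ^ 2) / ‖x‖) := by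
          rw [hud n hs]
          field_simp
          ring
        rw [this]
        refine (abs_add_le _ _).trans ?_
        rw [abs_mul (χ n _), abs_mul (_ * _) (_ / _), abs_of_nonneg (hχ0 n _)]
        exact add_le_add (mul_le_of_le_one_left (abs_nonneg _) (hχ1 n _))
          (mul_le_mul_of_nonneg_right (hχC n _ hs) (abs_nonneg _))
      have e2 : |u n (‖x‖ ^ 2) / ‖x‖| ≤ |f (‖x‖ ^ 2) / ‖x‖| := by
        simp only [u]
        rw [mul_div_assoc, abs_mul, abs_of_nonneg (hχ0 n _)]
        exact mul_le_of_le_one_left (abs_nonneg _) (hχ1 n _)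
      have e3 := mul_le_mul_of_nonneg_left e2 (abs_nonneg α)
      linarith
    · filter_upwards [ae_ne_zero_plane] with x hx
      have hx' : 0 < ‖x‖ := norm_pos_iff.2 hx
      have hs : 0 < ‖x‖ ^ 2 := pow_pos hx' 2
      have h1 : Tendsto (fun n => u n (‖x‖ ^ 2)) atTop (𝓝 (f (‖x‖ ^ 2))) := by
        simpa using (hχl _ hs).mul_const (f (‖x‖ ^ 2))
      have h2 : Tendsto (fun n => deriv (u n) (‖x‖ ^ 2)) atTop (𝓝 (deriv f (‖x‖ ^ 2))) := by
        have := (((hχl' _ hs).div_const (‖x‖ ^ 2)).mul_const (f (‖x‖ ^ 2))).add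
          ((hχl _ hs).mul_const (deriv f (‖x‖ ^ 2)))
        simp only [zero_div, zero_mul, one_mul, zero_add] at this
        refine this.congr fun n => ?_
        rw [hud n hs]
        field_simp
      simp only [hgrad _ x hx]
      refine ((PiLp.continuous_toLp 2 _).tendsto _).comp (tendsto_pi_nhds.2 fun j => ?_)
      have h1' := (Complex.continuous_ofReal.tendsto _).comp h1
      have h2' := (Complex.continuous_ofReal.tendsto _).comp h2
      exact (((h2'.const_mul 2).const_mul (-Complex.I)).mul_const _).add
        ((h1'.const_mul _).mul_const _)

theorem norm_sum_mul_le (a b : EuclideanSpace ℂ (Fin 2)) :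
    ‖∑ j, a j * b j‖ ≤ 2 * (‖a‖ * ‖b‖) := by
  rw [Fin.sum_univ_two, two_mul]
  refine (norm_add_le _ _).trans ?_
  rw [norm_mul, norm_mul]
  gcongr <;> exact PiLp.norm_apply_le _ _

theorem _root_.MeasureTheory.MemLp.norm_mul_norm {E F : Type*} [NormedAddCommGroup E] [NormedAddCommGroup F]
    {a : Plane → E} {b : Plane → F} (ha : MemLp a 2 volume) (hb : MemLp b 2 volume) :
    Integrable (fun x => ‖a x‖ * ‖b x‖) volume :=
  ha.norm.integrable_mul hb.norm

/-- The radial component of a function with finite energy satisfies a Hardy inequality. -/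
theorem HasWeakMagGrad.integrable_radial (hα : 0 < α) (hf : ContDiffOn ℝ ∞ f (Ioi 0))
    (hg : MemLp (fun x : Plane => (f (‖x‖ ^ 2) : ℂ)) 2 volume) {v : L2Field}
    (hv : HasWeakMagGrad α (hg.toLp _) v) :
    Integrable (fun x : Plane => f (‖x‖ ^ 2) ^ 2 / ‖x‖ ^ 2) volume := by
  obtain ⟨χ, C, hC, hχ, hχd, hχ0, hχ1, hχC, hχl, hχl'⟩ := exists_cutoff
  have hf' : ContDiffOn ℝ ∞ (fun s => (f s : ℂ)) (Ioi 0) :=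
    Complex.ofRealCLM.contDiff.comp_contDiffOn hf
  have hinv : ContDiffOn ℝ ∞ (fun s : ℝ => (s : ℂ)⁻¹) (Ioi 0) := by
    refine ContDiffOn.inv Complex.ofRealCLM.contDiff.contDiffOn fun s hs => ?_
    have : s ≠ 0 := ne_of_gt hs
    simpa using this
  let w : ℕ → Plane → ℝ := fun n x => χ n (‖x‖ ^ 2) ^ 2 * (f (‖x‖ ^ 2) ^ 2 / ‖x‖ ^ 2)
  have hχ2 : ∀ n, ContDiffOn ℝ ∞ (fun s => (χ n s : ℂ) * (f s * (s : ℂ)⁻¹)) (Ioi 0) := fun n =>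
    (hχ n).1.contDiffOn.mul (hf'.mul hinv)
  -- The test field `b x^⊥` is divergence free, so only the potential contributes: testing yields `α
  -- ∫ χ² f² / |x|²`, with no derivative of `f` or `χ`.
  let b : ℕ → ℝ → ℂ := fun n s => χ n s * (χ n s * (f s * (s : ℂ)⁻¹))
  have hb : ∀ n, IsProfile (b n) := fun n => (hχ n).mul_contDiffOn (hχ2 n)
  have h0 : IsProfile (fun _ => 0) := ⟨contDiff_const, 1, 1, one_pos, fun s hs => absurd rfl hs⟩
  have hw : ∀ n, ∀ x, ((w n x : ℝ) : ℂ) = f (‖x‖ ^ 2) * b n (‖x‖ ^ 2) := fun n x => by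
    simp only [w, b]
    push_cast
    ring
  have hwt : ∀ n, IsTestFunction (fun x => (w n x : ℂ)) := fun n => by
    have h1 : IsProfile fun s => b n s * f s := (hb n).mul_contDiffOn hf'
    have := h1.testFunction (p := fun _ => 1) contDiff_const
    simp only [hw]
    simpa [mul_comm] using this
  have hwI : ∀ n, Integrable (w n) := fun n => by
    have := memLp_one_iff_integrable.1 ((hwt n).memLp 1)
    simpa using this.re
  have hvI : Integrable (fun x => ‖v x‖ ^ 2) := (Lp.memLp v).norm.integrable_sq
  -- Young's inequality is weighted so that half of the left side can be absorbed. This leaves a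
  -- bound uniform in `n`, and Fatou's lemma removes the cutoff.
  have key : ∀ n, α * ∫ x, w n x ≤ α / 2 * (∫ x, w n x) + 2 / α * ∫ x, ‖v x‖ ^ 2 := by
    intro n
    have e1 := hv.integral_radialField h0 (hb n)
    have e2 : ∫ x, (hg.toLp _ : L2) x * (Complex.I * (2 * (0 : ℂ) + 2 * (‖x‖ ^ 2 : ℝ) *
        deriv (fun _ : ℝ => (0 : ℂ)) (‖x‖ ^ 2)) + α * b n (‖x‖ ^ 2)) =
        ((α * ∫ x, w n x : ℝ) : ℂ) := by
      rw [← integral_const_mul, ← integral_complex_ofReal]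
      refine integral_congr_ae ?_
      filter_upwards [hg.coeFn_toLp] with x hx
      rw [hx, Complex.ofReal_mul, hw]
      simp
      ring
    rw [e2] at e1
    have hnn : 0 ≤ α * ∫ x, w n x :=
      mul_nonneg hα.le (integral_nonneg fun x => by positivity)
    have e3 : α * ∫ x, w n x = ‖∫ x, ∑ j, radialField (fun _ => 0) (b n) x j * v x j‖ := by
      rw [e1, Complex.norm_real, Real.norm_of_nonneg hnn]
    rw [e3, ← integral_const_mul, ← integral_const_mul, ← integral_add ((hwI n).const_mul _)
      (hvI.const_mul _)]
    refine norm_integral_le_of_norm_le (((hwI n).const_mul _).add (hvI.const_mul _)) ?_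
    filter_upwards [ae_ne_zero_plane] with x hx
    have hx' : 0 < ‖x‖ := norm_pos_iff.2 hx
    refine (norm_sum_mul_le _ _).trans ?_
    have e4 : ‖radialField (fun _ => 0) (b n) x‖ ≤
        |χ n (‖x‖ ^ 2) * (f (‖x‖ ^ 2) / ‖x‖)| := by
      refine (norm_radialField_le _ _ x).trans ?_
      simp only [b, norm_zero, zero_mul, zero_add, norm_mul, Complex.norm_real, norm_inv,
        Real.norm_eq_abs, abs_mul, abs_div, abs_norm, abs_pow, abs_of_nonneg (hχ0 n (‖x‖ ^ 2))]
      have : χ n (‖x‖ ^ 2) * (χ n (‖x‖ ^ 2) * (|f (‖x‖ ^ 2)| * (‖x‖ ^ 2)⁻¹)) * ‖x‖ =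
          χ n (‖x‖ ^ 2) * (χ n (‖x‖ ^ 2) * (|f (‖x‖ ^ 2)| / ‖x‖)) := by
        field_simp
      rw [this]
      refine mul_le_of_le_one_left ?_ (hχ1 n _)
      exact mul_nonneg (hχ0 n _) (by positivity)
    set y := |χ n (‖x‖ ^ 2) * (f (‖x‖ ^ 2) / ‖x‖)| with hy
    have e5 : w n x = y ^ 2 := by
      rw [hy, sq_abs]
      simp only [w]
      ring
    have e6 : ‖radialField (fun _ => 0) (b n) x‖ * ‖v x‖ ≤ y * ‖v x‖ :=
      mul_le_mul_of_nonneg_right e4 (norm_nonneg _)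
    rw [e5]
    have e7 : α / 2 * y ^ 2 + 2 / α * ‖v x‖ ^ 2 - 2 * (y * ‖v x‖) =
        (α * y - 2 * ‖v x‖) ^ 2 / (2 * α) := by
      field_simp
      ring
    have e8 : 0 ≤ (α * y - 2 * ‖v x‖) ^ 2 / (2 * α) := by positivity
    linarith
  set K : ℝ := 2 / α * ∫ x, ‖v x‖ ^ 2 with hK
  have hbound : ∀ n, ∫⁻ x, ‖w n x‖ₑ ≤ ENNReal.ofReal (2 * K / α) := by
    intro n
    rw [← ofReal_integral_norm_eq_lintegral_enorm (hwI n)]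
    refine ENNReal.ofReal_le_ofReal ?_
    have : ∫ x, ‖w n x‖ = ∫ x, w n x :=
      integral_congr_ae (Eventually.of_forall fun x => Real.norm_of_nonneg (by positivity))
    rw [this, le_div_iff₀ hα]
    linarith [key n]
  refine ⟨aestronglyMeasurable_comp_norm_sq (f := fun s => f s ^ 2 / s)
    ((hf.continuousOn.pow 2).div continuousOn_id fun s hs => ne_of_gt hs), ?_⟩
  refine lt_of_le_of_lt ?_ (ENNReal.ofReal_lt_top (r := 2 * K / α))
  calc ∫⁻ x : Plane, ‖f (‖x‖ ^ 2) ^ 2 / ‖x‖ ^ 2‖ₑ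
      = ∫⁻ x, liminf (fun n => ‖w n x‖ₑ) atTop := by
        refine lintegral_congr_ae ?_
        filter_upwards [ae_ne_zero_plane] with x hx
        have hs : 0 < ‖x‖ ^ 2 := pow_pos (norm_pos_iff.2 hx) 2
        have := ((hχl _ hs).pow 2).mul_const (f (‖x‖ ^ 2) ^ 2 / ‖x‖ ^ 2)
        rw [one_pow, one_mul] at this
        exact this.enorm.liminf_eq.symm
    _ ≤ liminf (fun n => ∫⁻ x, ‖w n x‖ₑ) atTop :=
        lintegral_liminf_le' fun n => (hwI n).aestronglyMeasurable.enorm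
    _ ≤ _ := liminf_le_of_frequently_le' (Frequently.of_forall hbound)

/-- Green's formula: `⟨D f, D ψ⟩ = ⟨D² f, ψ⟩` for a radial function `f` with finite energy. -/
theorem HasWeakMagGrad.integral_radialGrad (hα : 0 < α) (hf : ContDiffOn ℝ ∞ f (Ioi 0))
    (hd : MemLp (fun x : Plane => ‖x‖ * deriv f (‖x‖ ^ 2)) 2 volume)
    (hr : MemLp (fun x : Plane => f (‖x‖ ^ 2) / ‖x‖) 2 volume) {k : ℝ → ℝ}
    (hode : ∀ s, 0 < s → 4 * s * deriv (deriv f) s + 4 * deriv f s - α ^ 2 * f s / s = k s)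
    (hk : MemLp (fun x : Plane => k (‖x‖ ^ 2)) 2 volume)
    {ψ : L2} {v : L2Field} (hv : HasWeakMagGrad α ψ v) :
    ∫ x, ∑ j, (starRingEnd ℂ) (radialGrad α f x j) * v x j =
      - ∫ x, ψ x * (k (‖x‖ ^ 2) : ℂ) := by
  obtain ⟨χ, C, hC, hχ, hχd, hχ0, hχ1, hχC, hχl, hχl'⟩ := exists_cutoff
  have hf' : ContDiffOn ℝ ∞ (fun s => (f s : ℂ)) (Ioi 0) :=
    Complex.ofRealCLM.contDiff.comp_contDiffOn hf
  have hdf := contDiffOn_deriv_Ioi hf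
  have hdf' : ContDiffOn ℝ ∞ (fun s => ((deriv f s : ℝ) : ℂ)) (Ioi 0) :=
    Complex.ofRealCLM.contDiff.comp_contDiffOn hdf
  have hinv : ContDiffOn ℝ ∞ (fun s : ℝ => (s : ℂ)⁻¹) (Ioi 0) := by
    refine ContDiffOn.inv Complex.ofRealCLM.contDiff.contDiffOn fun s hs => ?_
    have : s ≠ 0 := ne_of_gt hs
    simpa using this
  have hid : ContDiff ℝ ∞ (fun s : ℝ => (s : ℂ)) := Complex.ofRealCLM.contDiff
  have hχder : ∀ n s, deriv (fun s => (χ n s : ℂ)) s = (deriv (χ n) s : ℝ) := fun n s =>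
    deriv_ofReal_comp (hχd n s)
  let a : ℕ → ℝ → ℂ := fun n s => χ n s * (2 * Complex.I * (deriv f s : ℝ))
  let b₁ : ℕ → ℝ → ℂ := fun n s => χ n s * (α * (f s * (s : ℂ)⁻¹))
  -- The radial field `a x` has a divergence term `-4 s χ' f'` coming from the cutoff. The
  -- additional angular field `b₂ x^⊥` cancels it exactly, since the potential pairs with it to `α
  -- b₂ = 4 s χ' f'`. The error thus moves to the side of `v`, where it tends to 0 without any Hardy
  -- inequality for `ψ`.
  let b₂ : ℕ → ℝ → ℂ := fun n s => deriv (fun s => (χ n s : ℂ)) s *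
    (4 / α * (s * (deriv f s : ℝ)))
  have ha : ∀ n, IsProfile (a n) := fun n =>
    (hχ n).mul_contDiffOn (contDiffOn_const.mul hdf')
  have hb₁ : ∀ n, IsProfile (b₁ n) := fun n =>
    (hχ n).mul_contDiffOn (contDiffOn_const.mul (hf'.mul hinv))
  have hb₂ : ∀ n, IsProfile (b₂ n) := fun n =>
    (hχ n).deriv.mul_contDiffOn (contDiffOn_const.mul (hid.contDiffOn.mul hdf'))
  have hb : ∀ n, IsProfile (fun s => b₁ n s + b₂ n s) := by
    intro n
    refine ⟨(hb₁ n).1.add (hb₂ n).1, ?_⟩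
    obtain ⟨-, lo, hi, h0, h⟩ := hχ n
    refine ⟨lo, hi, h0, fun s hs => ?_⟩
    by_contra hc
    have h1 : (χ n s : ℂ) = 0 := by
      by_contra h'
      exact hc (h s h')
    have h2 : deriv (fun s => (χ n s : ℂ)) s = 0 := by
      by_contra h'
      exact hc (closure_minimal (fun s hs => h s hs) isClosed_Icc (support_deriv_subset h'))
    exact hs (by simp only [b₁, b₂, h1, h2, zero_mul, add_zero])
  have hda : ∀ n s, 0 < s → deriv (a n) s = 2 * Complex.I *
      ((deriv (χ n) s * deriv f s + χ n s * deriv (deriv f) s : ℝ) : ℂ) := by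
    intro n s hs
    have h1 : DifferentiableAt ℝ (deriv f) s :=
      (hdf.contDiffAt (Ioi_mem_nhds hs)).differentiableAt (by simp)
    have h2 := (((hχd n s).hasDerivAt.mul h1.hasDerivAt).ofReal_comp).const_mul (2 * Complex.I)
    refine HasDerivAt.deriv (h2.congr_of_eventuallyEq (Eventually.of_forall fun t => ?_))
    simp only [a, Pi.mul_apply]
    push_cast
    ring
  have hfield : ∀ n (x : Plane), x ≠ 0 → radialField (a n) (fun s => b₁ n s + b₂ n s) x =
      radialField (fun s => χ n s * (2 * Complex.I * (deriv f s : ℝ)))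
        (fun s => χ n s * (α * (f s * (s : ℂ)⁻¹)) +
          (s * deriv (χ n) s : ℝ) * (4 / α * (deriv f s : ℝ))) x := by
    intro n x hx
    ext j
    simp only [radialField, a, b₁, b₂, hχder]
    push_cast
    ring
  have key : ∀ n, ∫ x, ∑ j, radialField (a n) (fun s => b₁ n s + b₂ n s) x j * v x j =
      ∫ x, ψ x * (-(χ n (‖x‖ ^ 2) * k (‖x‖ ^ 2) : ℝ) : ℂ) := by
    intro n
    rw [hv.integral_radialField (ha n) (hb n)]
    refine integral_congr_ae ?_
    filter_upwards [ae_ne_zero_plane] with x hx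
    have hs : 0 < ‖x‖ ^ 2 := pow_pos (norm_pos_iff.2 hx) 2
    have hs' : ((‖x‖ ^ 2 : ℝ) : ℂ) ≠ 0 := by exact_mod_cast hs.ne'
    have hα' : (α : ℂ) ≠ 0 := by exact_mod_cast hα.ne'
    rw [hda n _ hs, ← hode _ hs]
    simp only [a, b₁, b₂, hχder]
    generalize ‖x‖ ^ 2 = s at hs hs'
    push_cast
    field_simp
    ring_nf
    simp only [Complex.I_sq]
    ring
  have hA : MemLp (fun x => v x) 2 volume := Lp.memLp v
  have hP : MemLp (fun x => ψ x) 2 volume := Lp.memLp ψ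
  have lim1 : Tendsto (fun n => ∫ x, ∑ j, radialField (a n) (fun s => b₁ n s + b₂ n s) x j *
      v x j) atTop (𝓝 (∫ x, ∑ j, (starRingEnd ℂ) (radialGrad α f x j) * v x j)) := by
    have hbd : MemLp (fun x : Plane => (2 + 4 * C / α) * ‖‖x‖ * deriv f (‖x‖ ^ 2)‖ +
        α * ‖f (‖x‖ ^ 2) / ‖x‖‖) 2 volume :=
      (hd.norm.const_mul (2 + 4 * C / α)).add (hr.norm.const_mul α)
    refine tendsto_integral_of_dominated_convergence (fun x : Plane =>
      2 * (((2 + 4 * C / α) * ‖‖x‖ * deriv f (‖x‖ ^ 2)‖ + α * ‖f (‖x‖ ^ 2) / ‖x‖‖) * ‖v x‖))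
      (fun n => ?_) ((hbd.integrable_mul hA.norm).const_mul 2) (fun n => ?_) ?_
    · refine Finset.aestronglyMeasurable_fun_sum _ fun j _ => ?_
      exact (isTestFunction_radialField (ha n) (hb n) j).1.continuous.aestronglyMeasurable.mul
        ((memLp_congr_ae (coeFn_fieldComp j v)).1 (Lp.memLp _)).aestronglyMeasurable
    · filter_upwards [ae_ne_zero_plane] with x hx
      have hx' : 0 < ‖x‖ := norm_pos_iff.2 hx
      have hs : 0 < ‖x‖ ^ 2 := pow_pos hx' 2
      refine (norm_sum_mul_le _ _).trans ?_
      gcongr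
      rw [hfield n x hx]
      refine (norm_radialField_le _ _ x).trans ?_
      have e1 : ‖(χ n (‖x‖ ^ 2) : ℂ) * (2 * Complex.I * (deriv f (‖x‖ ^ 2) : ℝ))‖ * ‖x‖ ≤
          2 * ‖‖x‖ * deriv f (‖x‖ ^ 2)‖ := by
        simp only [norm_mul, Complex.norm_real, Complex.norm_I, Complex.norm_ofNat, norm_norm,
          Real.norm_of_nonneg (hχ0 n (‖x‖ ^ 2)), mul_one]
        calc χ n (‖x‖ ^ 2) * (2 * ‖deriv f (‖x‖ ^ 2)‖) * ‖x‖
            = χ n (‖x‖ ^ 2) * (2 * (‖x‖ * ‖deriv f (‖x‖ ^ 2)‖)) := by ring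
          _ ≤ _ := mul_le_of_le_one_left (by positivity) (hχ1 n _)
      have e2 : ‖(χ n (‖x‖ ^ 2) : ℂ) * (α * (f (‖x‖ ^ 2) * ((‖x‖ ^ 2 : ℝ) : ℂ)⁻¹))‖ * ‖x‖ ≤
          α * ‖f (‖x‖ ^ 2) / ‖x‖‖ := by
        simp only [norm_mul, norm_inv, norm_div, Complex.norm_real, norm_norm, norm_pow,
          Real.norm_of_nonneg (hχ0 n (‖x‖ ^ 2)), Real.norm_of_nonneg hα.le]
        calc χ n (‖x‖ ^ 2) * (α * (‖f (‖x‖ ^ 2)‖ * (‖x‖ ^ 2)⁻¹)) * ‖x‖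
            = χ n (‖x‖ ^ 2) * (α * (‖f (‖x‖ ^ 2)‖ / ‖x‖)) := by field_simp
          _ ≤ _ := mul_le_of_le_one_left (by positivity) (hχ1 n _)
      have e3 : ‖((‖x‖ ^ 2 * deriv (χ n) (‖x‖ ^ 2) : ℝ) : ℂ) *
          (4 / α * (deriv f (‖x‖ ^ 2) : ℝ))‖ * ‖x‖ ≤
          4 * C / α * ‖‖x‖ * deriv f (‖x‖ ^ 2)‖ := by
        rw [norm_mul, Complex.norm_real, Real.norm_eq_abs]
        have e4 : ‖(4 / α * (deriv f (‖x‖ ^ 2) : ℝ) : ℂ)‖ = 4 / α * ‖deriv f (‖x‖ ^ 2)‖ := by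
          simp [abs_of_pos hα]
        rw [e4, norm_mul, norm_norm]
        calc _ ≤ C * (4 / α * ‖deriv f (‖x‖ ^ 2)‖) * ‖x‖ := by
              gcongr
              exact hχC n _ hs
          _ = _ := by ring
      have e5 := mul_le_mul_of_nonneg_right (norm_add_le
        ((χ n (‖x‖ ^ 2) : ℂ) * (α * (f (‖x‖ ^ 2) * ((‖x‖ ^ 2 : ℝ) : ℂ)⁻¹)))
        (((‖x‖ ^ 2 * deriv (χ n) (‖x‖ ^ 2) : ℝ) : ℂ) * (4 / α * (deriv f (‖x‖ ^ 2) : ℝ))))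
        (norm_nonneg x)
      rw [add_mul] at e5
      linarith
    · filter_upwards [ae_ne_zero_plane] with x hx
      have hs : 0 < ‖x‖ ^ 2 := pow_pos (norm_pos_iff.2 hx) 2
      refine tendsto_finsetSum _ fun j _ => Tendsto.mul_const _ ?_
      simp only [hfield _ x hx]
      have h1 := (Complex.continuous_ofReal.tendsto _).comp (hχl _ hs)
      have h2 := (Complex.continuous_ofReal.tendsto _).comp (hχl' _ hs)
      have := ((h1.mul_const (2 * Complex.I * (deriv f (‖x‖ ^ 2) : ℝ))).mul_const (x j : ℂ)).add
        (((h1.mul_const (α * (f (‖x‖ ^ 2) * ((‖x‖ ^ 2 : ℝ) : ℂ)⁻¹))).add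
          (h2.mul_const ((4 / α : ℂ) * ((deriv f (‖x‖ ^ 2) : ℝ) : ℂ)))).mul_const (perp x j : ℂ))
      convert! this using 2
      simp [radialGrad, radialField, perp, map_ofNat]
      ring
  have lim2 : Tendsto (fun n => ∫ x, ψ x * (-(χ n (‖x‖ ^ 2) * k (‖x‖ ^ 2) : ℝ) : ℂ)) atTop
      (𝓝 (∫ x, ψ x * (-(k (‖x‖ ^ 2) : ℝ) : ℂ))) := by
    have hkc := hk.ofReal (K := ℂ)
    refine tendsto_integral_of_dominated_convergence (fun x : Plane =>
      ‖ψ x‖ * ‖k (‖x‖ ^ 2)‖) (fun n => ?_) (hP.norm_mul_norm hk) (fun n => ?_) ?_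
    · have h1 : Continuous fun x : Plane => (χ n (‖x‖ ^ 2) : ℂ) :=
        (hχ n).1.continuous.comp (by fun_prop)
      have h2 := hP.aestronglyMeasurable.mul
        ((h1.aestronglyMeasurable.mul hkc.aestronglyMeasurable).neg)
      refine h2.congr (Eventually.of_forall fun x => ?_)
      simp
    · refine Eventually.of_forall fun x => ?_
      rw [norm_mul, norm_neg, Complex.norm_real, norm_mul, Real.norm_of_nonneg (hχ0 n _)]
      gcongr
      exact mul_le_of_le_one_left (norm_nonneg _) (hχ1 n _)
    · filter_upwards [ae_ne_zero_plane] with x hx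
      have hs : 0 < ‖x‖ ^ 2 := pow_pos (norm_pos_iff.2 hx) 2
      have h1 := (hχl _ hs).mul_const (k (‖x‖ ^ 2))
      rw [one_mul] at h1
      exact (((Complex.continuous_ofReal.tendsto _).comp h1).neg).const_mul _
  simp only [key] at lim1
  rw [tendsto_nhds_unique lim1 lim2, ← integral_neg]
  refine integral_congr_ae (Eventually.of_forall fun x => ?_)
  simp

end Radial

/-! ### The exponential change of variables -/

/-- Passing from the half-line to the whole line avoids boundary terms at 0 and exposes the symmetry
`u ↦ -u` of the Bessel integral. -/
theorem integral_exp_smul_comp_exp (G : ℝ → ℝ) :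
    ∫ u, Real.exp u * G (Real.exp u) = ∫ t in Ioi 0, G t := by
  have := integral_image_eq_integral_abs_deriv_smul (s := univ) (f := Real.exp) (f' := Real.exp)
    MeasurableSet.univ (fun x _ => (Real.hasDerivAt_exp x).hasDerivWithinAt)
    Real.exp_injective.injOn G
  simpa [image_univ, Real.range_exp] using this.symm

theorem integrable_exp_smul_comp_exp (G : ℝ → ℝ) :
    Integrable (fun u => Real.exp u * G (Real.exp u)) ↔ IntegrableOn G (Ioi 0) := by
  have := integrableOn_image_iff_integrableOn_abs_deriv_smul (s := univ) (f := Real.exp)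
    (f' := Real.exp) MeasurableSet.univ (fun x _ => (Real.hasDerivAt_exp x).hasDerivWithinAt)
    Real.exp_injective.injOn G
  simpa [image_univ, Real.range_exp] using this.symm

/-! ### The integrals `∫₀^∞ t^a exp (-s / t - κ t) dt` -/

/-- `∫₀^∞ t^a exp (-s / t - κ t) dt`. -/
noncomputable def heatIntegral (a κ s : ℝ) : ℝ :=
  ∫ t in Ioi (0 : ℝ), t ^ a * Real.exp (-s / t - κ * t)

theorem integrableOn_rpow_mul_exp_neg_mul {a κ : ℝ} (ha : -1 < a) (hκ : 0 < κ) :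
    IntegrableOn (fun t : ℝ => t ^ a * Real.exp (-κ * t)) (Ioi 0) := by
  simpa using integrableOn_rpow_mul_exp_neg_mul_rpow ha one_pos hκ

/-- From `(s/t)^N exp(-s/t) ≤ N!`: powers of `s` are traded for powers of `t`. This gives both
integrability at `t = 0` and decay as `s → ∞`. -/
theorem pow_mul_rpow_mul_exp_le (a κ : ℝ) {s t : ℝ} (hs : 0 ≤ s) (ht : 0 < t) (N : ℕ) :
    s ^ N * (t ^ (a - N) * Real.exp (-s / t - κ * t)) ≤
      N.factorial * (t ^ a * Real.exp (-κ * t)) := by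
  have h1 := Real.pow_div_factorial_le_exp (s / t) (by positivity) N
  rw [div_le_iff₀ (by positivity)] at h1
  have h2 : (s / t) ^ N * Real.exp (-s / t) ≤ N.factorial := by
    rw [neg_div, Real.exp_neg, ← div_eq_mul_inv, div_le_iff₀ (Real.exp_pos _)]
    linarith
  calc s ^ N * (t ^ (a - N) * Real.exp (-s / t - κ * t))
      = ((s / t) ^ N * Real.exp (-s / t)) * (t ^ a * Real.exp (-κ * t)) := by
        rw [Real.rpow_sub_natCast ht.ne', sub_eq_add_neg, Real.exp_add, neg_mul, div_pow]
        ring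
    _ ≤ _ := by gcongr

theorem continuousOn_rpow_mul_exp (a κ s : ℝ) :
    ContinuousOn (fun t : ℝ => t ^ a * Real.exp (-s / t - κ * t)) (Ioi 0) := by
  refine ContinuousOn.mul ?_ (Real.continuous_exp.comp_continuousOn ?_)
  · exact fun t ht => (Real.continuousAt_rpow_const t a (Or.inl (ne_of_gt ht))).continuousWithinAt
  · exact (continuousOn_const.div continuousOn_id fun t ht => ne_of_gt ht).sub (by fun_prop)

theorem integrableOn_heatIntegral (a : ℝ) {κ s : ℝ} (hκ : 0 < κ) (hs : 0 < s) :
    IntegrableOn (fun t : ℝ => t ^ a * Real.exp (-s / t - κ * t)) (Ioi 0) := by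
  -- So that `a + N > -1`, which makes the dominating power integrable at 0.
  obtain ⟨N, hN⟩ := exists_nat_gt (-1 - a)
  have h1 : IntegrableOn (fun t : ℝ => N.factorial / s ^ N * (t ^ (a + N) * Real.exp (-κ * t)))
      (Ioi 0) := (integrableOn_rpow_mul_exp_neg_mul (by linarith) hκ).const_mul _
  refine Integrable.mono' h1
    ((continuousOn_rpow_mul_exp a κ s).aestronglyMeasurable measurableSet_Ioi) ?_
  filter_upwards [ae_restrict_mem measurableSet_Ioi] with t ht
  have ht : 0 < t := ht
  rw [Real.norm_of_nonneg (by positivity)]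
  have := pow_mul_rpow_mul_exp_le (a + N) κ hs.le ht N
  rw [add_sub_cancel_right] at this
  rw [div_mul_eq_mul_div, le_div_iff₀ (by positivity)]
  linarith

theorem heatIntegral_nonneg (a κ s : ℝ) : 0 ≤ heatIntegral a κ s :=
  setIntegral_nonneg measurableSet_Ioi fun t ht => by
    have : (0 : ℝ) < t := ht
    positivity

theorem pow_mul_heatIntegral_le {a κ s : ℝ} (ha : -1 < a) (hκ : 0 < κ) (hs : 0 < s) (N : ℕ) :
    s ^ N * heatIntegral (a - N) κ s ≤
      N.factorial * ∫ t in Ioi (0 : ℝ), t ^ a * Real.exp (-κ * t) := by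
  rw [heatIntegral, ← integral_const_mul, ← integral_const_mul]
  refine setIntegral_mono_on ((integrableOn_heatIntegral _ hκ hs).const_mul _)
    ((integrableOn_rpow_mul_exp_neg_mul ha hκ).const_mul _) measurableSet_Ioi fun t ht => ?_
  exact pow_mul_rpow_mul_exp_le a κ hs.le ht N

theorem abs_exp_sub_exp_le {m κ κ' t : ℝ} (h : m ≤ κ) (h' : m ≤ κ') (ht : 0 ≤ t) :
    |Real.exp (-κ * t) - Real.exp (-κ' * t)| ≤ |κ - κ'| * (t * Real.exp (-m * t)) := by
  wlog hle : κ ≤ κ' generalizing κ κ'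
  · rw [abs_sub_comm, abs_sub_comm κ]
    exact this h' h (le_of_not_ge hle)
  have h1 : Real.exp (-κ' * t) ≤ Real.exp (-κ * t) := by
    apply Real.exp_le_exp.2
    nlinarith
  rw [abs_of_nonneg (sub_nonneg.2 h1), abs_sub_comm, abs_of_nonneg (sub_nonneg.2 hle)]
  have h2 : Real.exp (-κ' * t) = Real.exp (-κ * t) * Real.exp (-((κ' - κ) * t)) := by
    rw [← Real.exp_add]
    ring_nf
  have h3 := Real.add_one_le_exp (-((κ' - κ) * t))
  have h4 : Real.exp (-κ * t) ≤ Real.exp (-m * t) := by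
    apply Real.exp_le_exp.2
    nlinarith
  have h5 : 0 ≤ (κ' - κ) * t := mul_nonneg (sub_nonneg.2 hle) ht
  calc Real.exp (-κ * t) - Real.exp (-κ' * t)
      = Real.exp (-κ * t) * (1 - Real.exp (-((κ' - κ) * t))) := by rw [h2]; ring
    _ ≤ Real.exp (-κ * t) * ((κ' - κ) * t) := by
        gcongr
        linarith
    _ ≤ Real.exp (-m * t) * ((κ' - κ) * t) := by gcongr
    _ = _ := by ring

/-- The difference of the two exponentials gains a factor `t`. The exponent rises by one, and this
is how the singularities of `G_λ` and `G_μ` at the origin cancel. -/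
theorem abs_heatIntegral_sub_le (a : ℝ) {m κ κ' s : ℝ} (hm : 0 < m) (h : m ≤ κ) (h' : m ≤ κ')
    (hs : 0 < s) :
    |heatIntegral a κ s - heatIntegral a κ' s| ≤ |κ - κ'| * heatIntegral (a + 1) m s := by
  rw [heatIntegral, heatIntegral, heatIntegral,
    ← integral_sub (integrableOn_heatIntegral a (hm.trans_le h) hs)
    (integrableOn_heatIntegral a (hm.trans_le h') hs), ← integral_const_mul, ← Real.norm_eq_abs]
  refine norm_integral_le_of_norm_le ((integrableOn_heatIntegral _ hm hs).const_mul _) ?_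
  filter_upwards [ae_restrict_mem measurableSet_Ioi] with t ht
  have ht : 0 < t := ht
  have e : ∀ k, Real.exp (-s / t - k * t) = Real.exp (-s / t) * Real.exp (-k * t) := fun k => by
    rw [← Real.exp_add]; ring_nf
  rw [e, e, e, ← mul_sub, ← mul_sub, Real.norm_eq_abs, abs_mul, abs_mul,
    abs_of_pos (Real.rpow_pos_of_pos ht a), abs_of_pos (Real.exp_pos _), Real.rpow_add_one ht.ne']
  calc _ ≤ t ^ a * (Real.exp (-s / t) * (|κ - κ'| * (t * Real.exp (-m * t)))) := by
        gcongr
        exact abs_exp_sub_exp_le h h' ht.le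
    _ = _ := by ring

theorem hasDerivAt_heatIntegral (a : ℝ) {κ s : ℝ} (hκ : 0 < κ) (hs : 0 < s) :
    HasDerivAt (heatIntegral a κ) (-heatIntegral (a - 1) κ s) s := by
  -- Near `s` the variable stays above `s / 2`, and the integrand decreases as its argument grows,
  -- so its value at `s / 2` dominates.
  have h := hasDerivAt_integral_of_dominated_loc_of_deriv_le
    (μ := volume.restrict (Ioi (0 : ℝ))) (s := Ioi (s / 2)) (x₀ := s)
    (F := fun s t => t ^ a * Real.exp (-s / t - κ * t))
    (F' := fun s t => -(t ^ (a - 1) * Real.exp (-s / t - κ * t)))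
    (bound := fun t => t ^ (a - 1) * Real.exp (-(s / 2) / t - κ * t))
    (Ioi_mem_nhds (by linarith))
    (Eventually.of_forall fun s =>
      (continuousOn_rpow_mul_exp a κ s).aestronglyMeasurable measurableSet_Ioi)
    (integrableOn_heatIntegral a hκ hs)
    ((continuousOn_rpow_mul_exp (a - 1) κ s).aestronglyMeasurable measurableSet_Ioi).neg ?_
    (integrableOn_heatIntegral (a - 1) hκ (half_pos hs)) ?_
  · have h2 := h.2
    rw [integral_neg] at h2
    exact h2
  · filter_upwards [ae_restrict_mem measurableSet_Ioi] with t ht x hx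
    have ht : 0 < t := ht
    have hx : s / 2 < x := hx
    rw [norm_neg, Real.norm_of_nonneg (by positivity)]
    gcongr
  · filter_upwards [ae_restrict_mem measurableSet_Ioi] with t ht x hx
    have ht : 0 < t := ht
    have h1 : HasDerivAt (fun x : ℝ => -x / t - κ * t) (-1 / t) x :=
      ((hasDerivAt_id x).neg.div_const t).sub_const _
    convert! (h1.exp.const_mul (t ^ a)) using 1
    rw [Real.rpow_sub_one ht.ne']
    ring

/-- Differentiation in `s` only lowers the exponent by one and changes the sign, so the induction
runs over all exponents at once. -/
theorem contDiffOn_heatIntegral (a : ℝ) {κ : ℝ} (hκ : 0 < κ) :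
    ContDiffOn ℝ ∞ (heatIntegral a κ) (Ioi 0) := by
  refine contDiffOn_infty.2 fun n => ?_
  induction n generalizing a with
  | zero =>
    exact contDiffOn_zero.2 fun s hs =>
      (hasDerivAt_heatIntegral a hκ hs).continuousAt.continuousWithinAt
  | succ n ih =>
    rw [Nat.cast_succ]
    refine (contDiffOn_succ_iff_deriv_of_isOpen isOpen_Ioi).2 ⟨fun s hs =>
      (hasDerivAt_heatIntegral a hκ hs).differentiableAt.differentiableWithinAt,
      fun h => absurd h (WithTop.natCast_ne_top n), ?_⟩
    exact (ih (a - 1)).neg.congr fun s hs => (hasDerivAt_heatIntegral a hκ hs).deriv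

/-- Integration by parts in `t`. -/
theorem heatIntegral_recurrence (b : ℝ) {κ s : ℝ} (hκ : 0 < κ) (hs : 0 < s) :
    b * heatIntegral (b - 1) κ s + s * heatIntegral (b - 2) κ s = κ * heatIntegral b κ s := by
  let F : ℝ → ℝ → ℝ := fun c t => t ^ c * Real.exp (-s / t - κ * t)
  have hF : ∀ c, IntegrableOn (F c) (Ioi 0) := fun c => integrableOn_heatIntegral c hκ hs
  let F' : ℝ → ℝ := fun t => b * F (b - 1) t + s * F (b - 2) t - κ * F b t
  have hF' : IntegrableOn F' (Ioi 0) :=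
    (((hF _).const_mul b).add ((hF _).const_mul s)).sub ((hF _).const_mul κ)
  have hd : ∀ t, 0 < t → HasDerivAt (F b) (F' t) t := by
    intro t ht
    have h1 : HasDerivAt (fun t : ℝ => -s / t - κ * t) (s / t ^ 2 - κ) t := by
      have := ((hasDerivAt_inv ht.ne').const_mul (-s)).sub ((hasDerivAt_id t).const_mul κ)
      convert! this using 1
      field_simp
    have h2 := (Real.hasDerivAt_rpow_const (p := b) (Or.inl ht.ne')).mul h1.exp
    convert! h2 using 1
    simp only [F', F]
    have e1 : t ^ (b - 1) = t ^ b / t := Real.rpow_sub_one ht.ne' b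
    have e2 : t ^ (b - 2) = t ^ b / t ^ 2 := by
      have := Real.rpow_sub_natCast ht.ne' b 2
      simpa using this
    rw [e1, e2]
    field_simp
    ring
  -- After `t = e^u`, integrability of the function and of its derivative on the line suffices; no
  -- limits at 0 and `∞` are needed.
  have h0 : ∫ u, Real.exp u * F' (Real.exp u) = 0 := by
    refine integral_eq_zero_of_hasDerivAt_of_integrable (f := fun u => F b (Real.exp u))
      (fun u => ?_) ((integrable_exp_smul_comp_exp F').2 hF') ?_
    · have := (hd _ (Real.exp_pos u)).comp u (Real.hasDerivAt_exp u)
      rwa [mul_comm] at this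
    · refine ((integrable_exp_smul_comp_exp (F (b - 1))).2 (hF _)).congr
        (Eventually.of_forall fun u => ?_)
      simp only [F]
      rw [Real.rpow_sub_one (Real.exp_pos u).ne']
      have := (Real.exp_pos u).ne'
      field_simp
  rw [integral_exp_smul_comp_exp] at h0
  have h1 : ∫ t in Ioi 0, F' t = b * heatIntegral (b - 1) κ s + s * heatIntegral (b - 2) κ s -
      κ * heatIntegral b κ s := by
    simp only [F']
    rw [integral_sub (f := fun t => b * F (b - 1) t + s * F (b - 2) t) (((hF _).const_mul b).add ((hF _).const_mul s)) ((hF _).const_mul κ),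
      integral_add ((hF _).const_mul b) ((hF _).const_mul s), integral_const_mul,
      integral_const_mul, integral_const_mul]
    rfl
  linarith

/-! ### The defect function as a heat integral -/

/-- The profile of the defect function in the variable `s = |x|²`. -/
noncomputable def defectProfile (α lam s : ℝ) : ℝ :=
  2 ^ (α - 1) * (s ^ (α / 2) * heatIntegral (-α - 1) (lam ^ 2 / 4) s)

theorem heatIntegral_eq_besselK (α : ℝ) {lam r : ℝ} (hl : 0 < lam) (hr : 0 < r) :
    heatIntegral (-α - 1) (lam ^ 2 / 4) (r ^ 2) =
      2 * (2 * r / lam) ^ (-α) * besselK α (lam * r) := by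
  have hc : 0 < 2 * r / lam := by positivity
  -- The scaling `t ↦ c t` balances the two exponents into `-z (t + 1/t) / 2`, which becomes `-z
  -- cosh u` under `t = e^u`.
  set c := 2 * r / lam with hcdef
  set z := lam * r with hz
  have e1 : heatIntegral (-α - 1) (lam ^ 2 / 4) (r ^ 2) =
      c ^ (-α) * ∫ t in Ioi (0 : ℝ), t ^ (-α - 1) * Real.exp (-z * ((t + t⁻¹) / 2)) := by
    have := integral_comp_mul_left_Ioi' (fun t : ℝ => t ^ (-α - 1) *
      Real.exp (-r ^ 2 / t - lam ^ 2 / 4 * t)) 0 hc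
    rw [mul_zero] at this
    rw [heatIntegral, ← this, smul_eq_mul, ← integral_const_mul, ← integral_const_mul]
    refine setIntegral_congr_fun measurableSet_Ioi fun t ht => ?_
    have ht : 0 < t := ht
    have e3 : c ^ (-α - 1) = c ^ (-α) / c := Real.rpow_sub_one hc.ne' _
    have e4 : -r ^ 2 / (c * t) - lam ^ 2 / 4 * (c * t) = -z * ((t + t⁻¹) / 2) := by
      rw [hcdef, hz]
      field_simp
      ring
    rw [Real.mul_rpow hc.le ht.le, e3, e4]
    field_simp
  let F : ℝ → ℝ := fun u => Real.exp (-z * Real.cosh u) * Real.exp (-α * u)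
  have e2 : ∫ t in Ioi (0 : ℝ), t ^ (-α - 1) * Real.exp (-z * ((t + t⁻¹) / 2)) = ∫ u, F u := by
    rw [← integral_exp_smul_comp_exp]
    refine integral_congr_ae (Eventually.of_forall fun u => ?_)
    simp only [F]
    rw [← Real.exp_mul, Real.cosh_eq, ← Real.exp_neg, mul_comm (Real.exp _) (Real.exp (-α * u)),
      ← mul_assoc, ← Real.exp_add]
    congr 2
    ring
  have hFi : Integrable F := by
    have h1 := integrableOn_heatIntegral (-α - 1) (κ := z / 2) (s := z / 2) (by positivity)
      (by positivity)
    rw [← integrable_exp_smul_comp_exp] at h1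
    refine h1.congr (Eventually.of_forall fun u => ?_)
    simp only [F]
    rw [← Real.exp_mul, Real.cosh_eq, ← mul_assoc, ← Real.exp_add, ← Real.exp_add,
      ← Real.exp_add, neg_div, div_eq_mul_inv (z / 2), ← Real.exp_neg]
    congr 1
    ring
  have e5 : ∫ u, F u = ∫ u, Real.exp (-z * Real.cosh |u|) * Real.cosh (α * |u|) := by
    -- Averaging over `u` and `-u` replaces `exp(-α u)` by `cosh(α u)`.
    have h2 : ∫ u, F (-u) = ∫ u, F u := integral_neg_eq_self F volume
    have h3 : ∫ u, (F u + F (-u)) / 2 = ∫ u, F u := by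
      rw [integral_div, integral_add hFi hFi.comp_neg, h2]
      ring
    rw [← h3]
    refine integral_congr_ae (Eventually.of_forall fun u => ?_)
    have h4 : Real.cosh (α * |u|) = Real.cosh (α * u) := by
      rcases abs_choice u with h | h <;> rw [h]
      rw [mul_neg, Real.cosh_neg]
    simp only [F]
    rw [Real.cosh_abs, h4, Real.cosh_neg, Real.cosh_eq (α * u)]
    ring_nf
  rw [e1, e2, e5, integral_comp_abs (f := fun u => Real.exp (-z * Real.cosh u) *
    Real.cosh (α * u)), besselK]
  ring

theorem defectFun_eq_defectProfile (α : ℝ) {lam : ℝ} (hl : 0 < lam) {x : Plane} (hx : x ≠ 0) :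
    defectFun α lam x = defectProfile α lam (‖x‖ ^ 2) := by
  have hr : 0 < ‖x‖ := norm_pos_iff.2 hx
  rw [defectFun, defectProfile, heatIntegral_eq_besselK α hl hr]
  have e1 : (‖x‖ ^ 2) ^ (α / 2) = ‖x‖ ^ α := by
    rw [← Real.rpow_natCast, ← Real.rpow_mul hr.le]
    congr 1
    push_cast
    ring
  rw [e1, Real.rpow_neg (by positivity), Real.div_rpow (by positivity) hl.le,
    Real.mul_rpow zero_le_two hr.le, Real.rpow_sub_one two_ne_zero]
  have h1 : (2 : ℝ) ^ α ≠ 0 := (Real.rpow_pos_of_pos two_pos _).ne'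
  have h2 : ‖x‖ ^ α ≠ 0 := (Real.rpow_pos_of_pos hr _).ne'
  have h3 : lam ^ α ≠ 0 := (Real.rpow_pos_of_pos hl _).ne'
  field_simp

theorem contDiffOn_defectProfile (α : ℝ) {lam : ℝ} (hl : 0 < lam) :
    ContDiffOn ℝ ∞ (defectProfile α lam) (Ioi 0) := by
  refine contDiffOn_const.mul (ContDiffOn.mul ?_ (contDiffOn_heatIntegral _ (by positivity)))
  exact fun s hs => (Real.contDiffAt_rpow_const_of_ne (ne_of_gt hs)).contDiffWithinAt

theorem hasDerivAt_defectProfile (α : ℝ) {lam s : ℝ} (hl : 0 < lam) (hs : 0 < s) :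
    HasDerivAt (defectProfile α lam) (2 ^ (α - 1) *
      (α / 2 * s ^ (α / 2 - 1) * heatIntegral (-α - 1) (lam ^ 2 / 4) s +
        s ^ (α / 2) * -heatIntegral (-α - 2) (lam ^ 2 / 4) s)) s := by
  have h1 := hasDerivAt_heatIntegral (-α - 1) (κ := lam ^ 2 / 4) (by positivity) hs
  have h2 := Real.hasDerivAt_rpow_const (p := α / 2) (Or.inl hs.ne')
  rw [show -α - 1 - 1 = -α - 2 by ring] at h1
  exact (h2.mul h1).const_mul (2 ^ (α - 1))

theorem deriv_defectProfile (α : ℝ) {lam s : ℝ} (hl : 0 < lam) (hs : 0 < s) :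
    deriv (defectProfile α lam) s = 2 ^ (α - 1) *
      (α / 2 * s ^ (α / 2 - 1) * heatIntegral (-α - 1) (lam ^ 2 / 4) s +
        s ^ (α / 2) * -heatIntegral (-α - 2) (lam ^ 2 / 4) s) :=
  (hasDerivAt_defectProfile α hl hs).deriv

/-- The defect function is an eigenfunction of `D_α²` with eigenvalue `-λ²`. -/
theorem defectProfile_ode (α : ℝ) {lam s : ℝ} (hl : 0 < lam) (hs : 0 < s) :
    4 * s * deriv (deriv (defectProfile α lam)) s + 4 * deriv (defectProfile α lam) s -
      α ^ 2 * defectProfile α lam s / s = lam ^ 2 * defectProfile α lam s := by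
  have hκ : 0 < lam ^ 2 / 4 := by positivity
  have h1 := hasDerivAt_heatIntegral (-α - 1) hκ hs
  have h2 := hasDerivAt_heatIntegral (-α - 2) hκ hs
  have p1 := Real.hasDerivAt_rpow_const (p := α / 2) (Or.inl hs.ne')
  have p2 := Real.hasDerivAt_rpow_const (p := α / 2 - 1) (Or.inl hs.ne')
  have hd := (((p2.const_mul (α / 2)).mul h1).add (p1.mul h2.neg)).const_mul ((2 : ℝ) ^ (α - 1))
  have hd2 := (hd.congr_of_eventuallyEq (f₁ := deriv (defectProfile α lam)) (by
    filter_upwards [Ioi_mem_nhds hs] with t ht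
    exact deriv_defectProfile α hl ht)).deriv
  -- The differential equation is this recurrence, multiplied by `4 · 2^{α-1} s^{α/2}`, once the
  -- derivatives are written as heat integrals of lower exponent.
  have hrec := heatIntegral_recurrence (-α - 1) hκ hs
  have e1 : -α - 1 - 1 = -α - 2 := by ring
  have e2 : -α - 1 - 2 = -α - 3 := by ring
  have e3 : -α - 2 - 1 = -α - 3 := by ring
  rw [e1, e2] at hrec
  rw [hd2, deriv_defectProfile α hl hs, defectProfile, e1, e3, Pi.neg_apply, Real.rpow_sub_one hs.ne',
    Real.rpow_sub_one hs.ne']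
  generalize heatIntegral (-α - 1) (lam ^ 2 / 4) s = H at *
  generalize heatIntegral (-α - 2) (lam ^ 2 / 4) s = H1 at *
  generalize heatIntegral (-α - 3) (lam ^ 2 / 4) s = H2 at *
  generalize s ^ (α / 2) = p at *
  generalize (2 : ℝ) ^ (α - 1) = c at *
  have e4 : lam ^ 2 * (c * (p * H)) = 4 * c * p * (lam ^ 2 / 4 * H) := by ring
  rw [e4, ← hrec]
  field_simp
  ring

/-! ### Integrals of radial functions on the plane -/

theorem finrank_plane : Module.finrank ℝ Plane = 2 := by simp

theorem integrable_comp_norm_sq_iff (F : ℝ → ℝ) :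
    Integrable (fun x : Plane => F (‖x‖ ^ 2)) ↔ IntegrableOn F (Ioi 0) := by
  have h := integrable_fun_norm_addHaar (volume : Measure Plane) (f := fun r => F (r ^ 2))
  rw [h, finrank_plane, ← integrableOn_Ioi_comp_rpow_iff' F two_ne_zero]
  refine integrableOn_congr_fun (fun r hr => ?_) measurableSet_Ioi
  norm_num

/-- With `s = r²`, the radial measure `2π r dr` becomes `π ds`. -/
theorem integral_comp_norm_sq (F : ℝ → ℝ) :
    ∫ x : Plane, F (‖x‖ ^ 2) = Real.pi * ∫ s in Ioi 0, F s := by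
  have h := integral_fun_norm_addHaar (volume : Measure Plane) (fun r => F (r ^ 2))
  rw [h, finrank_plane, ← integral_comp_rpow_Ioi_of_pos (g := F) two_pos, measureReal_def,
    EuclideanSpace.volume_ball_fin_two]
  simp only [smul_eq_mul, nsmul_eq_mul, ENNReal.ofReal_one, one_pow, one_mul,
    ENNReal.toReal_ofReal Real.pi_pos.le]
  rw [mul_left_comm, Nat.cast_ofNat, ← integral_const_mul]
  congr 1
  refine setIntegral_congr_fun measurableSet_Ioi fun r hr => ?_
  norm_num
  ring

theorem integral_comp_norm (F : ℝ → ℝ) :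
    ∫ x : Plane, F ‖x‖ = 2 * Real.pi * ∫ r in Ioi 0, r * F r := by
  have h := integral_fun_norm_addHaar (volume : Measure Plane) F
  rw [h, finrank_plane, measureReal_def, EuclideanSpace.volume_ball_fin_two]
  simp [ENNReal.toReal_ofReal Real.pi_pos.le]
  ring

/-! ### Norms and scalar products of defect functions -/

theorem setLIntegral_ofReal_eq {S : Set ℝ} (hS : MeasurableSet S) {f : ℝ → ℝ}
    (hf : IntegrableOn f S) (h0 : ∀ t ∈ S, 0 ≤ f t) :
    ∫⁻ t in S, ENNReal.ofReal (f t) = ENNReal.ofReal (∫ t in S, f t) :=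
  (ofReal_integral_eq_lintegral_ofReal hf ((ae_restrict_mem hS).mono h0)).symm

/-- The second factor is at most a constant times `(1 + y)^{α-1}`, so the product decays like `(1 +
y)^{-2}`. -/
theorem integrableOn_feynman {α κ κ' : ℝ} (hα1 : α < 1) (hκ : 0 < κ) (hκ' : 0 < κ') :
    IntegrableOn (fun y : ℝ => (1 + y) ^ (-α - 1) * (κ + κ' * y) ^ (α - 1)) (Ioi 0) := by
  have hm : 0 < min κ κ' := lt_min hκ hκ'
  have h1 : IntegrableOn (fun y : ℝ => min κ κ' ^ (α - 1) * (y + 1) ^ (-2 : ℝ)) (Ioi 0) :=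
    (integrableOn_add_rpow_Ioi_of_lt (by norm_num) (by norm_num)).const_mul _
  refine Integrable.mono' h1 ?_ ?_
  · refine ContinuousOn.aestronglyMeasurable (fun y hy => ?_) measurableSet_Ioi
    have hy : 0 < y := hy
    refine ContinuousAt.continuousWithinAt (ContinuousAt.mul ?_ ?_)
    · exact (continuousAt_const.add continuousAt_id).rpow_const (Or.inl (by simp; positivity))
    · exact (by fun_prop : ContinuousAt (fun y => κ + κ' * y) y).rpow_const
        (Or.inl (by positivity))
  · filter_upwards [ae_restrict_mem measurableSet_Ioi] with y hy
    have hy : 0 < y := hy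
    rw [Real.norm_of_nonneg (by positivity)]
    have e1 : (y + 1) ^ (-2 : ℝ) = (1 + y) ^ (-α - 1) * (1 + y) ^ (α - 1) := by
      rw [← Real.rpow_add (by positivity), add_comm]
      ring_nf
    have e2 : (κ + κ' * y) ^ (α - 1) ≤ (min κ κ' * (1 + y)) ^ (α - 1) := by
      refine Real.rpow_le_rpow_of_nonpos (by positivity) ?_ (by linarith)
      have := min_le_left κ κ'
      have := mul_le_mul_of_nonneg_right (min_le_right κ κ') hy.le
      linarith
    rw [Real.mul_rpow hm.le (by positivity)] at e2
    calc _ ≤ (1 + y) ^ (-α - 1) * (min κ κ' ^ (α - 1) * (1 + y) ^ (α - 1)) := by gcongr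
      _ = _ := by rw [e1]; ring

/-- The Möbius function `(κ + κ' y) / (1 + y)` has derivative `(κ' - κ) / (1 + y)²` and runs from
`κ` to `κ'`, so its `α`-th power provides the antiderivative. -/
theorem integral_feynman {α κ κ' : ℝ} (hα0 : 0 < α) (hα1 : α < 1) (hκ : 0 < κ) (hκ' : 0 < κ') :
    (κ - κ') * ∫ y in Ioi (0 : ℝ), (1 + y) ^ (-α - 1) * (κ + κ' * y) ^ (α - 1) =
      (κ ^ α - κ' ^ α) / α := by
  rw [← integral_const_mul]
  have hlim : Tendsto (fun y : ℝ => (κ + κ' * y) / (1 + y)) atTop (𝓝 κ') := by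
    have h1 : Tendsto (fun y : ℝ => κ' + (κ - κ') / (1 + y)) atTop (𝓝 (κ' + 0)) :=
      tendsto_const_nhds.add (tendsto_const_nhds.div_atTop
        (tendsto_atTop_add_const_left _ _ tendsto_id))
    rw [add_zero] at h1
    refine h1.congr' ?_
    filter_upwards [eventually_gt_atTop 0] with y hy
    field_simp
    ring
  have h := integral_Ioi_of_hasDerivAt_of_tendsto' (a := 0)
    (f := fun y : ℝ => -(((κ + κ' * y) / (1 + y)) ^ α / α))
    (f' := fun y : ℝ => (κ - κ') * ((1 + y) ^ (-α - 1) * (κ + κ' * y) ^ (α - 1)))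
    (m := -(κ' ^ α / α)) (fun y hy => ?_) ((integrableOn_feynman hα1 hκ hκ').const_mul _) ?_
  · rw [h]
    simp
    ring
  · have hy : 0 ≤ y := hy
    have h1 : (0 : ℝ) < 1 + y := by positivity
    have h2 : 0 < κ + κ' * y := by positivity
    have hd1 : HasDerivAt (fun y : ℝ => κ + κ' * y) κ' y := by
      simpa using ((hasDerivAt_id y).const_mul κ').const_add κ
    have hd2 : HasDerivAt (fun y : ℝ => 1 + y) 1 y := (hasDerivAt_id y).const_add 1
    have hd := (((hd1.div hd2 h1.ne').rpow_const (p := α)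
      (Or.inl (by simp only [Pi.div_apply]; positivity))).div_const α).neg
    convert! hd using 1
    simp only [Pi.div_apply]
    rw [Real.div_rpow h2.le h1.le, show -α - 1 = -(α - 1) - 2 by ring,
      Real.rpow_sub h1, Real.rpow_neg h1.le, Real.rpow_two]
    have h3 := (Real.rpow_pos_of_pos h1 (α - 1)).ne'
    field_simp
    ring
  · refine Tendsto.neg (Tendsto.div_const ?_ α)
    exact (Real.continuousAt_rpow_const κ' α (Or.inl hκ'.ne')).tendsto.comp hlim

/-- The case `κ = κ'`, where `integral_feynman` only says `0 = 0`; it gives the norm of `G_λ`. -/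
theorem integral_feynman_self {α κ : ℝ} (hκ : 0 < κ) :
    ∫ y in Ioi (0 : ℝ), (1 + y) ^ (-α - 1) * (κ + κ * y) ^ (α - 1) = κ ^ (α - 1) := by
  have e : ∀ y ∈ Ioi (0 : ℝ), (1 + y) ^ (-α - 1) * (κ + κ * y) ^ (α - 1) =
      κ ^ (α - 1) * (y + 1) ^ (-2 : ℝ) := by
    intro y hy
    have hy : 0 < y := hy
    rw [show κ + κ * y = κ * (1 + y) by ring, Real.mul_rpow hκ.le (by positivity),
      mul_left_comm, ← Real.rpow_add (by positivity), add_comm y]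
    ring_nf
  rw [setIntegral_congr_fun measurableSet_Ioi e, integral_const_mul]
  have h := integral_Ioi_of_hasDerivAt_of_tendsto' (a := 0) (f := fun y : ℝ => -(y + 1)⁻¹)
    (f' := fun y : ℝ => (y + 1) ^ (-2 : ℝ)) (m := -0) (fun y hy => ?_)
    (integrableOn_add_rpow_Ioi_of_lt (by norm_num) (by norm_num)) ?_
  · rw [h]
    simp
  · have hy : 0 ≤ y := hy
    have h1 : y + 1 ≠ 0 := by positivity
    have := (((hasDerivAt_id y).add_const 1).inv h1).neg
    convert! this using 1
    rw [Real.rpow_neg (by positivity), Real.rpow_two, neg_div, neg_neg, one_div, id]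
  · exact (tendsto_inv_atTop_zero.comp (tendsto_atTop_add_const_right _ _ tendsto_id)).neg

/-- Write the product as a double integral over `t` and `t y`, then integrate in `s`, in `t` and in
`y`; the first two are Gamma integrals. Everything is nonnegative, so Tonelli applies with no prior
integrability, and finiteness of the result is what puts `G_λ` in `L²`. -/
theorem lintegral_heatIntegral_mul {α κ κ' : ℝ} (hα0 : 0 < α) (hα1 : α < 1) (hκ : 0 < κ)
    (hκ' : 0 < κ') :
    ∫⁻ s in Ioi (0 : ℝ), ENNReal.ofReal
      (s ^ α * (heatIntegral (-α - 1) κ s * heatIntegral (-α - 1) κ' s)) =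
    ENNReal.ofReal (Real.Gamma (α + 1) * Real.Gamma (1 - α) *
      ∫ y in Ioi (0 : ℝ), (1 + y) ^ (-α - 1) * (κ + κ' * y) ^ (α - 1)) := by
  -- The isolated factor `t` is the Jacobian of `t' = t y` in the second heat integral.
  let T : ℝ → ℝ → ℝ → ℝ := fun s t y => s ^ α * (t ^ (-α - 1) * Real.exp (-s / t - κ * t)) *
    (t * ((t * y) ^ (-α - 1) * Real.exp (-s / (t * y) - κ' * (t * y))))
  have hTm : Measurable fun p : ℝ × ℝ × ℝ => ENNReal.ofReal (T p.1 p.2.1 p.2.2) := by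
    refine ENNReal.measurable_ofReal.comp ?_
    simp only [T]
    fun_prop
  have hG1 : 0 < Real.Gamma (α + 1) := Real.Gamma_pos_of_pos (by linarith)
  have hG2 : 0 < Real.Gamma (1 - α) := Real.Gamma_pos_of_pos (by linarith)
  have step1 : ∀ s ∈ Ioi (0 : ℝ), ENNReal.ofReal
      (s ^ α * (heatIntegral (-α - 1) κ s * heatIntegral (-α - 1) κ' s)) =
      ∫⁻ t in Ioi (0 : ℝ), ∫⁻ y in Ioi (0 : ℝ), ENNReal.ofReal (T s t y) := by
    intro s hs
    have hs : 0 < s := hs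
    have h1 : ∀ t ∈ Ioi (0 : ℝ), ∫⁻ y in Ioi (0 : ℝ), ENNReal.ofReal (T s t y) =
        ENNReal.ofReal (s ^ α * heatIntegral (-α - 1) κ' s *
          (t ^ (-α - 1) * Real.exp (-s / t - κ * t))) := by
      intro t ht
      have ht : 0 < t := ht
      have hI : IntegrableOn (fun y => (t * y) ^ (-α - 1) *
          Real.exp (-s / (t * y) - κ' * (t * y))) (Ioi 0) := by
        have := (integrableOn_Ioi_comp_mul_left_iff (fun y => y ^ (-α - 1) *
          Real.exp (-s / y - κ' * y)) 0 ht).2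
        rw [mul_zero] at this
        exact this (integrableOn_heatIntegral _ hκ' hs)
      rw [setLIntegral_ofReal_eq measurableSet_Ioi ((hI.const_mul _).const_mul _)
        fun y hy => by
          have : 0 < y := hy
          positivity]
      have h2 := integral_comp_mul_left_Ioi' (fun y => y ^ (-α - 1) *
          Real.exp (-s / y - κ' * y)) 0 ht
      rw [mul_zero, smul_eq_mul] at h2
      rw [integral_const_mul, integral_const_mul, h2, ← heatIntegral]
      ring_nf
    rw [setLIntegral_congr_fun measurableSet_Ioi h1, setLIntegral_ofReal_eq measurableSet_Ioi
      ((integrableOn_heatIntegral _ hκ hs).const_mul _) fun t ht => ?_, integral_const_mul]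
    · rw [← heatIntegral]
      ring_nf
    · have : 0 < t := ht
      have := heatIntegral_nonneg (-α - 1) κ' s
      positivity
  have step2 : ∀ t ∈ Ioi (0 : ℝ), ∀ y ∈ Ioi (0 : ℝ),
      ∫⁻ s in Ioi (0 : ℝ), ENNReal.ofReal (T s t y) =
      ENNReal.ofReal (Real.Gamma (α + 1) * (1 + y) ^ (-α - 1) *
        (t ^ ((1 - α) - 1) * Real.exp (-((κ + κ' * y) * t)))) := by
    intro t ht y hy
    have ht : 0 < t := ht
    have hy : 0 < y := hy
    have hp : 0 < (1 + y) / (t * y) := by positivity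
    have e1 : ∀ s, T s t y = t ^ (-α - 1) * t * (t * y) ^ (-α - 1) *
        Real.exp (-((κ + κ' * y) * t)) *
        (s ^ ((α + 1) - 1) * Real.exp (-((1 + y) / (t * y) * s))) := by
      intro s
      have : Real.exp (-((κ + κ' * y) * t)) * Real.exp (-((1 + y) / (t * y) * s)) =
          Real.exp (-s / t - κ * t) * Real.exp (-s / (t * y) - κ' * (t * y)) := by
        rw [← Real.exp_add, ← Real.exp_add]
        congr 1
        field_simp
        ring
      simp only [T]
      rw [add_sub_cancel_right]
      linear_combination (-(t ^ (-α - 1) * t * (t * y) ^ (-α - 1) * s ^ α)) * this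
    have hI : IntegrableOn (fun s : ℝ => s ^ ((α + 1) - 1) *
        Real.exp (-((1 + y) / (t * y) * s))) (Ioi 0) := by
      have := integrableOn_rpow_mul_exp_neg_mul (a := α + 1 - 1) (by linarith) hp
      simpa only [neg_mul] using this
    simp only [e1]
    rw [setLIntegral_ofReal_eq measurableSet_Ioi (hI.const_mul _) fun s hs => by
        have : 0 < s := hs
        positivity, integral_const_mul, Real.integral_rpow_mul_exp_neg_mul_Ioi (by linarith) hp]
    congr 1
    rw [one_div_div, Real.div_rpow (by positivity) (by positivity),
      show (1 - α) - 1 = (-α - 1) + 1 by ring, Real.rpow_add_one ht.ne',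
      show -α - 1 = -(α + 1) by ring, Real.rpow_neg (by positivity : 0 ≤ t * y),
      Real.rpow_neg (by positivity : 0 ≤ 1 + y)]
    have := (Real.rpow_pos_of_pos (by positivity : 0 < t * y) (α + 1)).ne'
    field_simp
  have step3 : ∀ y ∈ Ioi (0 : ℝ), ∫⁻ t in Ioi (0 : ℝ),
      ENNReal.ofReal (Real.Gamma (α + 1) * (1 + y) ^ (-α - 1) *
        (t ^ ((1 - α) - 1) * Real.exp (-((κ + κ' * y) * t)))) =
      ENNReal.ofReal (Real.Gamma (α + 1) * Real.Gamma (1 - α) *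
        ((1 + y) ^ (-α - 1) * (κ + κ' * y) ^ (α - 1))) := by
    intro y hy
    have hy : 0 < y := hy
    have hp : 0 < κ + κ' * y := by positivity
    have hI : IntegrableOn (fun t : ℝ => t ^ ((1 - α) - 1) *
        Real.exp (-((κ + κ' * y) * t))) (Ioi 0) := by
      have := integrableOn_rpow_mul_exp_neg_mul (a := 1 - α - 1) (by linarith) hp
      simpa only [neg_mul] using this
    rw [setLIntegral_ofReal_eq measurableSet_Ioi (hI.const_mul _) fun t ht => by
        have : 0 < t := ht
        positivity, integral_const_mul, Real.integral_rpow_mul_exp_neg_mul_Ioi (by linarith) hp,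
      one_div, Real.inv_rpow hp.le, ← Real.rpow_neg hp.le, neg_sub]
    ring_nf
  have hswap : ∀ t, ∫⁻ s in Ioi (0 : ℝ), ∫⁻ y in Ioi (0 : ℝ), ENNReal.ofReal (T s t y) =
      ∫⁻ y in Ioi (0 : ℝ), ∫⁻ s in Ioi (0 : ℝ), ENNReal.ofReal (T s t y) := fun t =>
    lintegral_lintegral_swap (f := fun s y => ENNReal.ofReal (T s t y))
      (hTm.comp (by fun_prop : Measurable fun p : ℝ × ℝ => (p.1, t, p.2))).aemeasurable
  rw [setLIntegral_congr_fun measurableSet_Ioi step1,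
    lintegral_lintegral_swap (f := fun s t => ∫⁻ y in Ioi (0 : ℝ), ENNReal.ofReal (T s t y))
      (Measurable.lintegral_prod_right' (f := fun q : (ℝ × ℝ) × ℝ =>
        ENNReal.ofReal (T q.1.1 q.1.2 q.2)) (hTm.comp
        (by fun_prop : Measurable fun q : (ℝ × ℝ) × ℝ => (q.1.1, q.1.2, q.2)))).aemeasurable]
  simp only [hswap]
  rw [setLIntegral_congr_fun measurableSet_Ioi fun t ht =>
    setLIntegral_congr_fun measurableSet_Ioi fun y hy => step2 t ht y hy,
    lintegral_lintegral_swap (f := fun t y => ENNReal.ofReal (Real.Gamma (α + 1) *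
      (1 + y) ^ (-α - 1) * (t ^ ((1 - α) - 1) * Real.exp (-((κ + κ' * y) * t)))))
      (by
        refine (ENNReal.measurable_ofReal.comp ?_).aemeasurable
        fun_prop),
    setLIntegral_congr_fun measurableSet_Ioi step3,
    setLIntegral_ofReal_eq measurableSet_Ioi ((integrableOn_feynman hα1 hκ hκ').const_mul _)
      fun y hy => by
        have : 0 < y := hy
        positivity, integral_const_mul]

section

variable {α : ℝ} {lam mu : ℝ}

theorem sq_rpow {x : ℝ} (hx : 0 ≤ x) (p : ℝ) : (x ^ 2) ^ p = x ^ (2 * p) := by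
  rw [← Real.rpow_natCast, ← Real.rpow_mul hx, Nat.cast_ofNat]

theorem defectProfile_mul {s : ℝ} (hs : 0 < s) :
    defectProfile α lam s * defectProfile α mu s = 4 ^ (α - 1) * (s ^ α *
      (heatIntegral (-α - 1) (lam ^ 2 / 4) s * heatIntegral (-α - 1) (mu ^ 2 / 4) s)) := by
  have e1 : s ^ α = s ^ (α / 2) * s ^ (α / 2) := by
    rw [← Real.rpow_add hs, add_halves]
  have e2 : (4 : ℝ) ^ (α - 1) = 2 ^ (α - 1) * 2 ^ (α - 1) := by
    rw [← Real.mul_rpow zero_le_two zero_le_two]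
    norm_num
  rw [e1, e2, defectProfile, defectProfile]
  ring

theorem integrableOn_defectProfile_mul (hα0 : 0 < α) (hα1 : α < 1) (hl : 0 < lam) (hm : 0 < mu) :
    IntegrableOn (fun s => defectProfile α lam s * defectProfile α mu s) (Ioi 0) := by
  refine ⟨((contDiffOn_defectProfile α hl).continuousOn.mul
    (contDiffOn_defectProfile α hm).continuousOn).aestronglyMeasurable measurableSet_Ioi, ?_⟩
  have h := lintegral_heatIntegral_mul (α := α) (κ := lam ^ 2 / 4) (κ' := mu ^ 2 / 4) hα0 hα1
    (by positivity) (by positivity)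
  rw [HasFiniteIntegral]
  have e : ∀ s ∈ Ioi (0 : ℝ), ‖defectProfile α lam s * defectProfile α mu s‖ₑ =
      ENNReal.ofReal (4 ^ (α - 1)) * ENNReal.ofReal (s ^ α *
      (heatIntegral (-α - 1) (lam ^ 2 / 4) s * heatIntegral (-α - 1) (mu ^ 2 / 4) s)) := by
    intro s hs
    have hs : 0 < s := hs
    have h1 := heatIntegral_nonneg (-α - 1) (lam ^ 2 / 4) s
    have h2 := heatIntegral_nonneg (-α - 1) (mu ^ 2 / 4) s
    rw [defectProfile_mul hs, Real.enorm_of_nonneg (by positivity),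
      ENNReal.ofReal_mul (by positivity)]
  rw [setLIntegral_congr_fun measurableSet_Ioi e,
    lintegral_const_mul' _ _ ENNReal.ofReal_ne_top, h]
  exact ENNReal.mul_lt_top ENNReal.ofReal_lt_top ENNReal.ofReal_lt_top

/-- The constant is `Γ(α+1) Γ(1-α) = α π / sin(πα)` by the reflection formula, times `π` from the
plane; `4^{α-1}` comes from the prefactors of the two profiles. -/
theorem integral_defectProfile_mul (hα0 : 0 < α) (hα1 : α < 1) (hl : 0 < lam) (hm : 0 < mu) :
    ∫ x : Plane, defectProfile α lam (‖x‖ ^ 2) * defectProfile α mu (‖x‖ ^ 2) =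
      4 ^ (α - 1) * (α * (Real.pi ^ 2 / Real.sin (Real.pi * α))) *
        ∫ y in Ioi (0 : ℝ), (1 + y) ^ (-α - 1) * (lam ^ 2 / 4 + mu ^ 2 / 4 * y) ^ (α - 1) := by
  rw [integral_comp_norm_sq (fun s => defectProfile α lam s * defectProfile α mu s),
    setIntegral_congr_fun measurableSet_Ioi fun s hs => defectProfile_mul hs,
    integral_const_mul]
  have h := lintegral_heatIntegral_mul (α := α) (κ := lam ^ 2 / 4) (κ' := mu ^ 2 / 4) hα0 hα1
    (by positivity) (by positivity)
  have hI : IntegrableOn (fun s => s ^ α * (heatIntegral (-α - 1) (lam ^ 2 / 4) s *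
      heatIntegral (-α - 1) (mu ^ 2 / 4) s)) (Ioi 0) := by
    have := (integrableOn_defectProfile_mul hα0 hα1 hl hm).const_mul ((4 ^ (α - 1))⁻¹)
    refine IntegrableOn.congr_fun this (fun s hs => ?_) measurableSet_Ioi
    have h4 : (4 : ℝ) ^ (α - 1) ≠ 0 := by positivity
    simp only [defectProfile_mul hs]
    field_simp
  have hnn : ∀ s ∈ Ioi (0 : ℝ), 0 ≤ s ^ α * (heatIntegral (-α - 1) (lam ^ 2 / 4) s *
      heatIntegral (-α - 1) (mu ^ 2 / 4) s) := fun s hs => by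
    have : (0 : ℝ) < s := hs
    have h1 := heatIntegral_nonneg (-α - 1) (lam ^ 2 / 4) s
    have h2 := heatIntegral_nonneg (-α - 1) (mu ^ 2 / 4) s
    positivity
  rw [setLIntegral_ofReal_eq measurableSet_Ioi hI hnn] at h
  have hG1 : 0 < Real.Gamma (α + 1) := Real.Gamma_pos_of_pos (by linarith)
  have hG2 : 0 < Real.Gamma (1 - α) := Real.Gamma_pos_of_pos (by linarith)
  have hB : 0 ≤ ∫ y in Ioi (0 : ℝ),
      (1 + y) ^ (-α - 1) * (lam ^ 2 / 4 + mu ^ 2 / 4 * y) ^ (α - 1) :=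
    setIntegral_nonneg measurableSet_Ioi fun y hy => by
      have : (0 : ℝ) < y := hy
      positivity
  rw [ENNReal.ofReal_eq_ofReal_iff (setIntegral_nonneg measurableSet_Ioi hnn)
    (by positivity)] at h
  rw [h, Real.Gamma_add_one hα0.ne', mul_assoc α, Real.Gamma_mul_Gamma_one_sub]
  ring

theorem memLp_defectProfile (hα0 : 0 < α) (hα1 : α < 1) (hl : 0 < lam) :
    MemLp (fun x : Plane => defectProfile α lam (‖x‖ ^ 2)) 2 volume := by
  rw [memLp_two_iff_integrable_sq (aestronglyMeasurable_comp_norm_sq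
    (contDiffOn_defectProfile α hl).continuousOn)]
  rw [integrable_comp_norm_sq_iff (fun s => defectProfile α lam s ^ 2)]
  simpa only [sq] using integrableOn_defectProfile_mul hα0 hα1 hl hl

theorem integral_defectProfile_sq_eq (hα0 : 0 < α) (hα1 : α < 1) (hl : 0 < lam) :
    ∫ x : Plane, defectProfile α lam (‖x‖ ^ 2) * defectProfile α lam (‖x‖ ^ 2) =
      α * (Real.pi ^ 2 / Real.sin (Real.pi * α)) * lam ^ (2 * α - 2) := by
  rw [integral_defectProfile_mul hα0 hα1 hl hl, integral_feynman_self (by positivity),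
    Real.div_rpow (by positivity) (by positivity), sq_rpow hl.le,
    show 2 * (α - 1) = 2 * α - 2 by ring]
  have h4 : (4 : ℝ) ^ (α - 1) ≠ 0 := by positivity
  field_simp

/-- In polar coordinates `α c_α = ‖G_1‖²`, which has just been computed. -/
theorem cConst_eq (hα0 : 0 < α) (hα1 : α < 1) :
    cConst α = Real.pi ^ 2 / Real.sin (Real.pi * α) := by
  have h1 := integral_defectProfile_sq_eq hα0 hα1 one_pos
  have h2 : ∫ x : Plane, defectProfile α 1 (‖x‖ ^ 2) * defectProfile α 1 (‖x‖ ^ 2) =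
      ∫ x : Plane, besselK α ‖x‖ ^ 2 := by
    refine integral_congr_ae ?_
    filter_upwards [ae_ne_zero_plane] with x hx
    rw [← defectFun_eq_defectProfile α one_pos hx, defectFun, Real.one_rpow, one_mul, one_mul, sq]
  rw [h2, integral_comp_norm (fun r => besselK α r ^ 2), Real.one_rpow, mul_one] at h1
  rw [cConst, div_mul_eq_mul_div, h1]
  field_simp

theorem integral_defectProfile_sq (hα0 : 0 < α) (hα1 : α < 1) (hl : 0 < lam) :
    lam ^ 2 * ∫ x : Plane, defectProfile α lam (‖x‖ ^ 2) * defectProfile α lam (‖x‖ ^ 2) =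
      α * cConst α * lam ^ (2 * α) := by
  rw [integral_defectProfile_sq_eq hα0 hα1 hl, cConst_eq hα0 hα1, Real.rpow_sub hl,
    Real.rpow_two]
  field_simp

/-- The resolvent identity for the defect functions. -/
theorem integral_defectProfile_mul_sub (hα0 : 0 < α) (hα1 : α < 1) (hl : 0 < lam) (hm : 0 < mu) :
    (lam ^ 2 - mu ^ 2) *
      ∫ x : Plane, defectProfile α lam (‖x‖ ^ 2) * defectProfile α mu (‖x‖ ^ 2) =
      cConst α * (lam ^ (2 * α) - mu ^ (2 * α)) := by
  have h := integral_feynman (κ := lam ^ 2 / 4) (κ' := mu ^ 2 / 4) hα0 hα1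
    (by positivity) (by positivity)
  rw [Real.div_rpow (by positivity) (by positivity), Real.div_rpow (by positivity) (by positivity),
    sq_rpow hl.le, sq_rpow hm.le] at h
  rw [integral_defectProfile_mul hα0 hα1 hl hm, cConst_eq hα0 hα1, Real.rpow_sub_one (by norm_num)]
  have h4 : (4 : ℝ) ^ α ≠ 0 := by positivity
  generalize (∫ y in Ioi (0 : ℝ),
    (1 + y) ^ (-α - 1) * (lam ^ 2 / 4 + mu ^ 2 / 4 * y) ^ (α - 1)) = B at h ⊢
  generalize Real.pi ^ 2 / Real.sin (Real.pi * α) = c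
  field_simp at h ⊢
  linear_combination c * h

end

/-! ### Differences of defect functions have finite energy -/

/-- In the variable `s` the squared function is at most `C² s^{α-1} / (1 + s)²`: integrable at 0
because `α > 0`, and below `C² s^{-2}` beyond 1 because `α < 1`. -/
theorem memLp_of_abs_le_rpow_div {α C : ℝ} (hα0 : 0 < α) (hα1 : α < 1) {F : ℝ → ℝ}
    (hF : ContinuousOn F (Ioi 0)) (hle : ∀ s, 0 < s → |F s| ≤ C * (s ^ (α / 2) / (1 + s))) :
    MemLp (fun x : Plane => F (‖x‖ ^ 2) / ‖x‖) 2 volume := by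
  have hsq : ∀ x : Plane, F (‖x‖ ^ 2) / ‖x‖ = F (‖x‖ ^ 2) / Real.sqrt (‖x‖ ^ 2) := fun x => by
    rw [Real.sqrt_sq (norm_nonneg x)]
  simp only [hsq]
  have hcont : ContinuousOn (fun s => F s / Real.sqrt s) (Ioi 0) :=
    hF.div (by fun_prop) fun s hs => (Real.sqrt_pos.2 hs).ne'
  rw [memLp_two_iff_integrable_sq
    (aestronglyMeasurable_comp_norm_sq (f := fun s => F s / Real.sqrt s) hcont),
    integrable_comp_norm_sq_iff (fun s => (F s / Real.sqrt s) ^ 2)]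
  have hb : ∀ s ∈ Ioi (0 : ℝ), ‖(F s / Real.sqrt s) ^ 2‖ ≤
      C ^ 2 * (s ^ (α - 1) / (1 + s) ^ 2) := by
    intro s hs
    have hs : 0 < s := hs
    have h1 : F s ^ 2 ≤ (C * (s ^ (α / 2) / (1 + s))) ^ 2 := by
      rw [← sq_abs]
      exact pow_le_pow_left₀ (abs_nonneg _) (hle s hs) 2
    have h2 : (s ^ (α / 2)) ^ 2 = s ^ α := by
      rw [← Real.rpow_natCast, ← Real.rpow_mul hs.le]
      norm_num
    rw [Real.norm_of_nonneg (by positivity), div_pow, Real.sq_sqrt hs.le, Real.rpow_sub_one hs.ne',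
      div_le_iff₀ hs]
    refine h1.trans (le_of_eq ?_)
    rw [mul_pow, div_pow, h2]
    field_simp
  rw [← Ioc_union_Ioi_eq_Ioi zero_le_one, integrableOn_union]
  have hmeas : ∀ S ⊆ Ioi (0 : ℝ), MeasurableSet S →
      AEStronglyMeasurable (fun s => (F s / Real.sqrt s) ^ 2) (volume.restrict S) :=
    fun S hS hm => ((hcont.pow 2).mono hS).aestronglyMeasurable hm
  constructor
  · have h1 : IntegrableOn (fun s : ℝ => C ^ 2 * s ^ (α - 1)) (Ioc 0 1) :=
      (((intervalIntegral.intervalIntegrable_rpow' (by linarith)).1).const_mul _)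
    refine Integrable.mono' h1 (hmeas _ (fun s hs => hs.1) measurableSet_Ioc) ?_
    filter_upwards [ae_restrict_mem measurableSet_Ioc] with s hs
    have hs0 : 0 < s := hs.1
    refine (hb s hs0).trans ?_
    gcongr
    exact div_le_self (by positivity) (one_le_pow₀ (by linarith))
  · have h1 : IntegrableOn (fun s : ℝ => C ^ 2 * s ^ (-2 : ℝ)) (Ioi 1) :=
      (integrableOn_Ioi_rpow_of_lt (by norm_num) one_pos).const_mul _
    refine Integrable.mono' h1 (hmeas _ (fun s hs => lt_trans one_pos (mem_Ioi.1 hs)) measurableSet_Ioi) ?_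
    filter_upwards [ae_restrict_mem measurableSet_Ioi] with s hs
    have hs1 : 1 < s := hs
    have hs0 : 0 < s := one_pos.trans hs1
    refine (hb s hs0).trans ?_
    gcongr
    rw [Real.rpow_neg hs0.le, Real.rpow_two, div_eq_mul_inv]
    refine (mul_le_of_le_one_left (by positivity)
      (Real.rpow_le_one_of_one_le_of_nonpos hs1.le (by linarith))).trans ?_
    gcongr
    linarith

section

variable {α : ℝ} {lam mu : ℝ}

/-- Subtraction raises the exponent `-α - 1` to `-α`, which is integrable at `t = 0`, so the
difference of heat integrals is bounded uniformly in `s`. Further powers of `s` are paid for by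
`pow_mul_heatIntegral_le`. -/
theorem exists_abs_defectProfile_sub_le (hα0 : 0 < α) (hα1 : α < 1) (hl : 0 < lam)
    (hm : 0 < mu) : ∃ C, ∀ s, 0 < s →
      |defectProfile α lam s - defectProfile α mu s| ≤ C * (s ^ (α / 2) / (1 + s)) ∧
      |s * (deriv (defectProfile α lam) s - deriv (defectProfile α mu) s)| ≤
        C * (s ^ (α / 2) / (1 + s)) := by
  set κ := lam ^ 2 / 4 with hκdef
  set κ' := mu ^ 2 / 4 with hκ'def
  have hκ : 0 < κ := by positivity
  have hκ' : 0 < κ' := by positivity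
  set m := min κ κ' with hmdef
  have hm0 : 0 < m := lt_min hκ hκ'
  let I : ℝ → ℝ := fun a => ∫ t in Ioi (0 : ℝ), t ^ a * Real.exp (-m * t)
  have hI : ∀ a, 0 ≤ I a := fun a => setIntegral_nonneg measurableSet_Ioi fun t ht => by
    have : (0 : ℝ) < t := ht
    positivity
  -- The factor 2 is the `2!` produced by the bound with `N = 2` in `b2`.
  set M := 2 * (I (-α) + I (1 - α)) with hM
  have hM0 : 0 ≤ M := mul_nonneg zero_le_two (add_nonneg (hI _) (hI _))
  set δ := |κ - κ'|
  have hδ : 0 ≤ δ := abs_nonneg _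
  have b1 : ∀ s, 0 < s →
      |heatIntegral (-α - 1) κ s - heatIntegral (-α - 1) κ' s| ≤ δ * (M / (1 + s)) := by
    intro s hs
    refine (abs_heatIntegral_sub_le _ hm0 (min_le_left _ _) (min_le_right _ _) hs).trans ?_
    rw [sub_add_cancel]
    refine mul_le_mul_of_nonneg_left ?_ hδ
    rw [le_div_iff₀ (by positivity)]
    have h0 := pow_mul_heatIntegral_le (a := -α) (by linarith) hm0 hs 0
    have h1 := pow_mul_heatIntegral_le (a := 1 - α) (by linarith) hm0 hs 1
    simp only [pow_zero, one_mul, Nat.cast_zero, sub_zero, Nat.factorial_zero, Nat.cast_one,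
      pow_one, Nat.factorial_one, show 1 - α - 1 = -α by ring] at h0 h1
    have := hI (-α)
    have := hI (1 - α)
    change _ ≤ I (-α) at h0
    change _ ≤ I (1 - α) at h1
    linarith
  have b2 : ∀ s, 0 < s →
      s * |heatIntegral (-α - 2) κ s - heatIntegral (-α - 2) κ' s| ≤ δ * (M / (1 + s)) := by
    intro s hs
    have h := abs_heatIntegral_sub_le (-α - 2) hm0 (min_le_left κ κ') (min_le_right _ _) hs
    rw [show -α - 2 + 1 = -α - 1 by ring] at h
    have h' := mul_le_mul_of_nonneg_left h hs.le
    refine h'.trans ?_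
    rw [mul_left_comm]
    refine mul_le_mul_of_nonneg_left ?_ hδ
    rw [le_div_iff₀ (by positivity)]
    have h0 := pow_mul_heatIntegral_le (a := -α) (by linarith) hm0 hs 1
    have h1 := pow_mul_heatIntegral_le (a := 1 - α) (by linarith) hm0 hs 2
    simp only [one_mul, Nat.cast_one, pow_one, Nat.factorial_one, Nat.factorial_two,
      Nat.cast_ofNat, show 1 - α - 2 = -α - 1 by ring] at h0 h1
    have := hI (-α)
    have := hI (1 - α)
    change _ ≤ I (-α) at h0
    change _ ≤ 2 * I (1 - α) at h1
    nlinarith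
  refine ⟨2 * (2 ^ (α - 1) * (δ * M)), fun s hs => ⟨?_, ?_⟩⟩
  · have e : defectProfile α lam s - defectProfile α mu s = 2 ^ (α - 1) * (s ^ (α / 2) *
        (heatIntegral (-α - 1) κ s - heatIntegral (-α - 1) κ' s)) := by
      simp only [defectProfile]
      ring
    rw [e, abs_mul, abs_mul, abs_of_pos (Real.rpow_pos_of_pos two_pos _),
      abs_of_pos (Real.rpow_pos_of_pos hs _)]
    calc _ ≤ 2 ^ (α - 1) * (s ^ (α / 2) * (δ * (M / (1 + s)))) := by
          gcongr
          exact b1 s hs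
      _ = 2 ^ (α - 1) * (δ * M) * (s ^ (α / 2) / (1 + s)) := by ring
      _ ≤ _ := by
          have : 0 ≤ 2 ^ (α - 1) * (δ * M) := by positivity
          exact mul_le_mul_of_nonneg_right (by linarith) (by positivity)
  · have e : s * (deriv (defectProfile α lam) s - deriv (defectProfile α mu) s) =
        2 ^ (α - 1) * (s ^ (α / 2) *
          (α / 2 * (heatIntegral (-α - 1) κ s - heatIntegral (-α - 1) κ' s) -
          s * (heatIntegral (-α - 2) κ s - heatIntegral (-α - 2) κ' s))) := by
      rw [deriv_defectProfile α hl hs, deriv_defectProfile α hm hs, Real.rpow_sub_one hs.ne']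
      field_simp
      ring
    rw [e, abs_mul, abs_mul, abs_of_pos (Real.rpow_pos_of_pos two_pos _),
      abs_of_pos (Real.rpow_pos_of_pos hs _)]
    calc _ ≤ 2 ^ (α - 1) * (s ^ (α / 2) * (1 * (δ * (M / (1 + s))) + δ * (M / (1 + s)))) := by
          gcongr
          refine (abs_sub _ _).trans ?_
          rw [abs_mul, abs_mul, abs_of_pos hs, abs_of_pos (half_pos hα0)]
          exact add_le_add (mul_le_mul (by linarith) (b1 s hs) (abs_nonneg _) zero_le_one)
            (b2 s hs)
      _ = _ := by ring

theorem memLp_ofReal_plane {F : Plane → ℝ} (hF : MemLp F 2 volume) :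
    MemLp (fun x => (F x : ℂ)) 2 volume :=
  Complex.ofRealCLM.comp_memLp' hF

/-- The defect function as an element of `L²`. -/
noncomputable def defectLp (hα0 : 0 < α) (hα1 : α < 1) (hl : 0 < lam) : L2 :=
  (memLp_ofReal_plane (memLp_defectProfile hα0 hα1 hl)).toLp _

theorem coeFn_defectLp (hα0 : 0 < α) (hα1 : α < 1) (hl : 0 < lam) :
    ∀ᵐ x : Plane, defectLp hα0 hα1 hl x = (defectProfile α lam (‖x‖ ^ 2) : ℂ) :=
  (memLp_ofReal_plane (memLp_defectProfile hα0 hα1 hl)).coeFn_toLp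

theorem coeFn_defectLp_eq_defectFun (hα0 : 0 < α) (hα1 : α < 1) (hl : 0 < lam) :
    ∀ᵐ x : Plane, defectLp hα0 hα1 hl x = (defectFun α lam x : ℂ) := by
  filter_upwards [coeFn_defectLp hα0 hα1 hl, ae_ne_zero_plane] with x h hx
  rw [h, defectFun_eq_defectProfile α hl hx]

theorem inner_defectLp (hα0 : 0 < α) (hα1 : α < 1) (hl : 0 < lam) (hm : 0 < mu) :
    inner ℂ (defectLp hα0 hα1 hl) (defectLp hα0 hα1 hm) =
      ((∫ x : Plane, defectProfile α lam (‖x‖ ^ 2) * defectProfile α mu (‖x‖ ^ 2) : ℝ) : ℂ) := by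
  rw [L2.inner_def, ← integral_complex_ofReal]
  refine integral_congr_ae ?_
  filter_upwards [coeFn_defectLp hα0 hα1 hl, coeFn_defectLp hα0 hα1 hm] with x h1 h2
  rw [h1, h2]
  simp [mul_comm]

theorem contDiffOn_defectProfile_sub (hl : 0 < lam) (hm : 0 < mu) :
    ContDiffOn ℝ ∞ (fun s => defectProfile α lam s - defectProfile α mu s) (Ioi 0) :=
  (contDiffOn_defectProfile α hl).sub (contDiffOn_defectProfile α hm)

theorem differentiableAt_of_contDiffOn_Ioi {f : ℝ → ℝ} (hf : ContDiffOn ℝ ∞ f (Ioi 0)) {s : ℝ}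
    (hs : 0 < s) : DifferentiableAt ℝ f s :=
  (hf.contDiffAt (Ioi_mem_nhds hs)).differentiableAt (by simp)

theorem deriv_sub_of_contDiffOn_Ioi {f g : ℝ → ℝ} (hf : ContDiffOn ℝ ∞ f (Ioi 0))
    (hg : ContDiffOn ℝ ∞ g (Ioi 0)) {s : ℝ} (hs : 0 < s) :
    deriv (fun s => f s - g s) s = deriv f s - deriv g s :=
  deriv_fun_sub (differentiableAt_of_contDiffOn_Ioi hf hs) (differentiableAt_of_contDiffOn_Ioi hg hs)

/-- `G_λ - G_μ` is in the Friedrichs domain, with Green's formula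
`⟨D (G_λ - G_μ), D φ⟩ = ⟨μ² G_μ - λ² G_λ, φ⟩`. -/
theorem exists_gradient_defectLp_sub (hα0 : 0 < α) (hα1 : α < 1) (hl : 0 < lam) (hm : 0 < mu) :
    ∃ w : L2Field, (defectLp hα0 hα1 hl - defectLp hα0 hα1 hm, w) ∈ friedrichsGraph α ∧
      ∀ (φ : L2) (v : L2Field), HasWeakMagGrad α φ v → inner ℂ w v =
        inner ℂ (((mu ^ 2 : ℝ) : ℂ) • defectLp hα0 hα1 hm -
          ((lam ^ 2 : ℝ) : ℂ) • defectLp hα0 hα1 hl) φ := by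
  have hfl := contDiffOn_defectProfile α hl
  have hfm := contDiffOn_defectProfile α hm
  have hf := contDiffOn_defectProfile_sub (α := α) hl hm
  set f : ℝ → ℝ := fun s => defectProfile α lam s - defectProfile α mu s with hfdef
  obtain ⟨C, hC⟩ := exists_abs_defectProfile_sub_le hα0 hα1 hl hm
  have hml := memLp_defectProfile hα0 hα1 hl
  have hmm := memLp_defectProfile hα0 hα1 hm
  have hg : MemLp (fun x : Plane => (f (‖x‖ ^ 2) : ℂ)) 2 volume :=
    memLp_ofReal_plane (hml.sub hmm)
  have hr : MemLp (fun x : Plane => f (‖x‖ ^ 2) / ‖x‖) 2 volume :=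
    memLp_of_abs_le_rpow_div hα0 hα1 hf.continuousOn fun s hs => (hC s hs).1
  have hd1 : ∀ s, 0 < s → deriv f s =
      deriv (defectProfile α lam) s - deriv (defectProfile α mu) s := fun s hs =>
    deriv_sub_of_contDiffOn_Ioi hfl hfm hs
  have hd2 : ∀ s, 0 < s → deriv (deriv f) s =
      deriv (deriv (defectProfile α lam)) s - deriv (deriv (defectProfile α mu)) s := by
    intro s hs
    rw [← deriv_sub_of_contDiffOn_Ioi (contDiffOn_deriv_Ioi hfl) (contDiffOn_deriv_Ioi hfm) hs]
    refine Filter.EventuallyEq.deriv_eq ?_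
    filter_upwards [Ioi_mem_nhds hs] with t ht using hd1 t ht
  have hd : MemLp (fun x : Plane => ‖x‖ * deriv f (‖x‖ ^ 2)) 2 volume := by
    have h := memLp_of_abs_le_rpow_div (F := fun s => s * deriv f s) hα0 hα1
      (continuousOn_id.mul (contDiffOn_deriv_Ioi hf).continuousOn) fun s hs => by
        rw [hd1 s hs]
        exact (hC s hs).2
    refine (memLp_congr_ae ?_).1 h
    filter_upwards [ae_ne_zero_plane] with x hx
    have hx' : ‖x‖ ≠ 0 := norm_ne_zero_iff.2 hx
    field_simp
  have hode : ∀ s, 0 < s → 4 * s * deriv (deriv f) s + 4 * deriv f s - α ^ 2 * f s / s =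
      lam ^ 2 * defectProfile α lam s - mu ^ 2 * defectProfile α mu s := by
    intro s hs
    rw [hd1 s hs, hd2 s hs, ← defectProfile_ode α hl hs, ← defectProfile_ode α hm hs]
    simp only [hfdef]
    ring
  have hk : MemLp (fun x : Plane => lam ^ 2 * defectProfile α lam (‖x‖ ^ 2) -
      mu ^ 2 * defectProfile α mu (‖x‖ ^ 2)) 2 volume :=
    (hml.const_mul _).sub (hmm.const_mul _)
  have hgraph := toLp_radial_mem_friedrichsGraph (α := α) hf hg hd hr
  have heq : hg.toLp _ = defectLp hα0 hα1 hl - defectLp hα0 hα1 hm := by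
    refine Lp.ext ?_
    filter_upwards [hg.coeFn_toLp, coeFn_defectLp hα0 hα1 hl, coeFn_defectLp hα0 hα1 hm,
      Lp.coeFn_sub (defectLp hα0 hα1 hl) (defectLp hα0 hα1 hm)] with x h1 h2 h3 h4
    rw [h1, h4, Pi.sub_apply, h2, h3]
    simp [hfdef]
  rw [heq] at hgraph
  refine ⟨_, hgraph, fun φ v hv => ?_⟩
  have key := hv.integral_radialGrad hα0 hf hd hr
    (k := fun s => lam ^ 2 * defectProfile α lam s - mu ^ 2 * defectProfile α mu s) hode hk
  rw [← integral_neg] at key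
  rw [L2.inner_def, L2.inner_def]
  refine Eq.trans (integral_congr_ae ?_) (key.trans (integral_congr_ae ?_))
  · filter_upwards [(memLp_radialGrad (α := α) hf hd hr).coeFn_toLp] with x hx
    rw [hx, PiLp.inner_apply]
    refine Finset.sum_congr rfl fun j _ => ?_
    simp [mul_comm]
  · filter_upwards [coeFn_defectLp hα0 hα1 hl, coeFn_defectLp hα0 hα1 hm,
      Lp.coeFn_sub (((mu ^ 2 : ℝ) : ℂ) • defectLp hα0 hα1 hm)
        (((lam ^ 2 : ℝ) : ℂ) • defectLp hα0 hα1 hl),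
      Lp.coeFn_smul ((mu ^ 2 : ℝ) : ℂ) (defectLp hα0 hα1 hm),
      Lp.coeFn_smul ((lam ^ 2 : ℝ) : ℂ) (defectLp hα0 hα1 hl)] with x h1 h2 h3 h4 h5
    rw [h3, Pi.sub_apply, h4, h5, Pi.smul_apply, Pi.smul_apply, h1, h2]
    simp
    ring

/-! ### Infinite energy of the defect function -/

theorem heatIntegral_le_heatIntegral {a κ κ' s s' : ℝ} (hκ : 0 < κ) (hs : 0 < s) (hκκ : κ ≤ κ')
    (hss : s ≤ s') : heatIntegral a κ' s' ≤ heatIntegral a κ s := by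
  refine setIntegral_mono_on (integrableOn_heatIntegral a (hκ.trans_le hκκ) (hs.trans_le hss))
    (integrableOn_heatIntegral a hκ hs) measurableSet_Ioi fun u hu => ?_
  have hu : 0 < u := hu
  gcongr

theorem heatIntegral_pos (a : ℝ) {κ s : ℝ} (hκ : 0 < κ) (hs : 0 < s) : 0 < heatIntegral a κ s := by
  rw [heatIntegral, setIntegral_pos_iff_support_of_nonneg_ae]
  · have : Function.support (fun t : ℝ => t ^ a * Real.exp (-s / t - κ * t)) ∩ Ioi 0 = Ioi 0 := by
      refine inter_eq_right.2 fun t ht => ?_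
      have ht : 0 < t := ht
      exact (by positivity : t ^ a * Real.exp (-s / t - κ * t) ≠ 0)
    rw [this]
    simp
  · filter_upwards [ae_restrict_mem measurableSet_Ioi] with t ht
    have ht : 0 < t := ht
    exact (by positivity : 0 ≤ t ^ a * Real.exp (-s / t - κ * t))
  · exact integrableOn_heatIntegral a hκ hs

/-- Scaling `t` by `√s` absorbs the prefactor and leaves an expression that is visibly decreasing in
`s`. Its value at `s = 1` then bounds the profile from below on `(0, 1]`. -/
theorem rpow_mul_heatIntegral (α κ : ℝ) {s : ℝ} (hs : 0 < s) :
    s ^ (α / 2) * heatIntegral (-α - 1) κ s =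
      heatIntegral (-α - 1) (κ * Real.sqrt s) (Real.sqrt s) := by
  have hr : 0 < Real.sqrt s := Real.sqrt_pos.2 hs
  have hsq : Real.sqrt s * Real.sqrt s = s := Real.mul_self_sqrt hs.le
  set r := Real.sqrt s
  have h := integral_comp_mul_left_Ioi' (fun t : ℝ => t ^ (-α - 1) *
    Real.exp (-s / t - κ * t)) 0 hr
  rw [mul_zero, smul_eq_mul] at h
  rw [heatIntegral, ← h, ← integral_const_mul, ← integral_const_mul, heatIntegral]
  refine setIntegral_congr_fun measurableSet_Ioi fun t ht => ?_
  have ht : 0 < t := ht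
  have e1 : s ^ (α / 2) = r ^ α := by
    rw [← hsq, ← sq, sq_rpow hr.le]
    ring_nf
  have e2 : -s / (r * t) - κ * (r * t) = -r / t - κ * r * t := by
    rw [← hsq]
    field_simp
  rw [e1, e2, Real.mul_rpow hr.le ht.le, Real.rpow_sub_one hr.ne', Real.rpow_neg hr.le]
  have := (Real.rpow_pos_of_pos hr α).ne'
  field_simp

theorem exists_le_defectProfile (α : ℝ) (hl : 0 < lam) :
    ∃ c, 0 < c ∧ ∀ s ∈ Ioc (0 : ℝ) 1, c ≤ defectProfile α lam s := by
  have hκ : 0 < lam ^ 2 / 4 := by positivity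
  refine ⟨2 ^ (α - 1) * heatIntegral (-α - 1) (lam ^ 2 / 4) 1,
    mul_pos (by positivity) (heatIntegral_pos _ hκ one_pos), fun s hs => ?_⟩
  have h1 : Real.sqrt s ≤ 1 := Real.sqrt_le_one.2 hs.2
  have h0 : 0 < Real.sqrt s := Real.sqrt_pos.2 hs.1
  rw [defectProfile, rpow_mul_heatIntegral α _ hs.1]
  gcongr
  exact heatIntegral_le_heatIntegral (by positivity) h0 (mul_le_of_le_one_right hκ.le h1) h1

/-- The defect function has infinite energy. -/
theorem not_hasWeakMagGrad_defectLp (hα0 : 0 < α) (hα1 : α < 1) (hl : 0 < lam) (v : L2Field) :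
    ¬ HasWeakMagGrad α (defectLp hα0 hα1 hl) v := by
  intro hv
  have h := hv.integrable_radial hα0 (contDiffOn_defectProfile α hl)
  rw [integrable_comp_norm_sq_iff (fun s => defectProfile α lam s ^ 2 / s)] at h
  obtain ⟨c, hc, hle⟩ := exists_le_defectProfile α hl
  -- A positive lower bound for `G_λ` near the origin already contradicts the Hardy inequality,
  -- since `1/s` is not integrable there.
  have h1 : IntegrableOn (fun s : ℝ => s⁻¹) (Ioc 0 1) := by
    refine Integrable.mono' ((h.mono_set Ioc_subset_Ioi_self).const_mul (c ^ 2)⁻¹)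
      (measurable_inv.aestronglyMeasurable) ?_
    filter_upwards [ae_restrict_mem measurableSet_Ioc] with s hs
    have hs0 : 0 < s := hs.1
    rw [Real.norm_of_nonneg (by positivity), ← div_eq_inv_mul, le_div_iff₀ (by positivity),
      inv_mul_eq_div]
    gcongr
    exact hle s hs
  have h2 : IntervalIntegrable (fun s : ℝ => s⁻¹) volume 0 1 :=
    (intervalIntegrable_iff_integrableOn_Ioc_of_le zero_le_one).2 h1
  rw [intervalIntegrable_inv_iff] at h2
  simp at h2

end

/-! ### The form in terms of decompositions -/

section

variable {α : ℝ} {lam mu : ℝ}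

theorem isDecomposition_iff (hα0 : 0 < α) (hα1 : α < 1) (hl : 0 < lam) {ψ φ : L2} {q : ℂ} :
    IsDecomposition α lam ψ φ q ↔
      φ ∈ friedrichsDomain α ∧ ψ = φ + q • defectLp hα0 hα1 hl := by
  have hq : ∀ᵐ x : Plane, (φ + q • defectLp hα0 hα1 hl : L2) x =
      φ x + q * (defectFun α lam x : ℂ) := by
    filter_upwards [Lp.coeFn_add φ (q • defectLp hα0 hα1 hl),
      Lp.coeFn_smul q (defectLp hα0 hα1 hl), coeFn_defectLp_eq_defectFun hα0 hα1 hl]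
      with x h1 h2 h3
    rw [h1, Pi.add_apply, h2, Pi.smul_apply, h3, smul_eq_mul]
  refine and_congr_right fun _ => ⟨fun h => Lp.ext ?_, ?_⟩
  · filter_upwards [h, hq] with x h1 h2
    rw [h1, h2]
  · rintro rfl
    exact hq

theorem defectLp_mem_L2even (hα0 : 0 < α) (hα1 : α < 1) (hl : 0 < lam) :
    defectLp hα0 hα1 hl ∈ L2even := by
  have h := coeFn_defectLp hα0 hα1 hl
  have h' := (Measure.measurePreserving_neg (volume : Measure Plane)).quasiMeasurePreserving.ae h
  filter_upwards [h, h'] with x hx hx'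
  rw [hx, hx', norm_neg]

theorem add_smul_defectLp_mem_L2even (hα0 : 0 < α) (hα1 : α < 1) (hl : 0 < lam) {φ : L2}
    (hφ : φ ∈ L2even) (q : ℂ) : φ + q • defectLp hα0 hα1 hl ∈ L2even := by
  have h := defectLp_mem_L2even hα0 hα1 hl
  rw [mem_L2even_iff] at h hφ ⊢
  rw [map_add, map_smul, h, hφ]

/-- The decomposition is unique. -/
theorem eq_of_add_smul_defectLp_eq (hα0 : 0 < α) (hα1 : α < 1) (hl : 0 < lam) {φ φ' : L2}
    {v v' : L2Field} {q q' : ℂ} (h : (φ, v) ∈ friedrichsGraph α)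
    (h' : (φ', v') ∈ friedrichsGraph α)
    (he : φ + q • defectLp hα0 hα1 hl = φ' + q' • defectLp hα0 hα1 hl) :
    φ = φ' ∧ q = q' := by
  have hq : q = q' := by
    by_contra hne
    have h0 : q - q' ≠ 0 := sub_ne_zero.2 hne
    -- Unequal coefficients would make the defect function a multiple of a function of finite
    -- energy.
    have h1 : defectLp hα0 hα1 hl = (q - q')⁻¹ • (φ' - φ) := by
      rw [eq_inv_smul_iff₀ h0, sub_smul]
      rw [← sub_eq_zero] at he ⊢
      rw [← he]
      abel
    have h2 := (friedrichsGraph α).smul_mem (q - q')⁻¹ (sub_mem h' h)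
    rw [Prod.mk_sub_mk, Prod.smul_mk, ← h1] at h2
    exact not_hasWeakMagGrad_defectLp hα0 hα1 hl _ h2.2.1
  subst hq
  exact ⟨add_right_cancel he, rfl⟩

theorem anyonExpr_eq (hα0 : 0 < α) (hα1 : α < 1) (hl : 0 < lam) (β : ℝ) {φ : L2} {v : L2Field}
    (h : HasWeakMagGrad α φ v) (q : ℂ) :
    anyonExpr α β lam φ q = ‖v‖ ^ 2
      - 2 * lam ^ 2 * (q * inner ℂ φ (defectLp hα0 hα1 hl)).re
      + (β + (1 - α) * cConst α * lam ^ (2 * α)) * ‖q‖ ^ 2 := by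
  have e : ∫ x, (starRingEnd ℂ) (φ x) * (defectFun α lam x : ℂ) =
      inner ℂ φ (defectLp hα0 hα1 hl) := by
    rw [L2.inner_def]
    refine integral_congr_ae ?_
    filter_upwards [coeFn_defectLp_eq_defectFun hα0 hα1 hl] with x hx
    rw [hx]
    simp [mul_comm]
  rw [anyonExpr, h.magForm_eq, e]

theorem re_mul_inner_smul_left (q : ℂ) (x y : L2) :
    (q * inner ℂ (q • x) y).re = ‖q‖ ^ 2 * (inner ℂ x y).re := by
  rw [inner_smul_left, ← mul_assoc, Complex.mul_conj, Complex.re_ofReal_mul,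
    Complex.normSq_eq_norm_sq]

/-- The expression of the form does not depend on `λ`. -/
theorem exists_anyonExpr_eq (hα0 : 0 < α) (hα1 : α < 1) (hl : 0 < lam) (hm : 0 < mu) (β : ℝ)
    {φ : L2} {v : L2Field} (h : (φ, v) ∈ friedrichsGraph α) (q : ℂ) :
    ∃ φ' v', (φ', v') ∈ friedrichsGraph α ∧
      φ + q • defectLp hα0 hα1 hl = φ' + q • defectLp hα0 hα1 hm ∧
      anyonExpr α β mu φ' q = anyonExpr α β lam φ q := by
  obtain ⟨w, hw, hgreen⟩ := exists_gradient_defectLp_sub hα0 hα1 hl hm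
  have h' := add_mem h ((friedrichsGraph α).smul_mem q hw)
  rw [Prod.smul_mk, Prod.mk_add_mk] at h'
  refine ⟨_, _, h', ?_, ?_⟩
  · rw [smul_sub]
    abel
  rw [anyonExpr_eq hα0 hα1 hm β h'.2.1, anyonExpr_eq hα0 hα1 hl β h.2.1]
  have hp := integral_defectProfile_mul_sub hα0 hα1 hl hm
  have hnl := integral_defectProfile_sq hα0 hα1 hl
  have hnm := integral_defectProfile_sq hα0 hα1 hm
  have il := inner_defectLp hα0 hα1 hl hl
  have im := inner_defectLp hα0 hα1 hm hm
  have ilm := inner_defectLp hα0 hα1 hl hm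
  have iml := inner_defectLp hα0 hα1 hm hl
  simp only [mul_comm (defectProfile α mu _) (defectProfile α lam _)] at iml
  generalize (∫ x : Plane, defectProfile α lam (‖x‖ ^ 2) * defectProfile α mu (‖x‖ ^ 2)) = P
    at hp ilm iml
  generalize (∫ x : Plane, defectProfile α lam (‖x‖ ^ 2) * defectProfile α lam (‖x‖ ^ 2)) = Nl
    at hnl il
  generalize (∫ x : Plane, defectProfile α mu (‖x‖ ^ 2) * defectProfile α mu (‖x‖ ^ 2)) = Nm
    at hnm im
  have g1 := hgreen _ _ h.2.1
  have g2 := hgreen _ _ hw.2.1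
  set Gl := defectLp hα0 hα1 hl
  set Gm := defectLp hα0 hα1 hm
  -- Green's formula applied to `G_λ - G_μ` itself.
  have e1 : ‖w‖ ^ 2 = (lam ^ 2 + mu ^ 2) * P - lam ^ 2 * Nl - mu ^ 2 * Nm := by
    rw [← inner_self_eq_norm_sq (𝕜 := ℂ), g2]
    simp only [inner_sub_left, inner_sub_right, inner_smul_left, il, im, ilm, iml,
      Complex.conj_ofReal, RCLike.re_to_complex]
    norm_cast
    ring
  have e2 : RCLike.re (inner ℂ v (q • w)) =
      mu ^ 2 * (q * inner ℂ φ Gm).re - lam ^ 2 * (q * inner ℂ φ Gl).re := by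
    rw [inner_smul_right, ← inner_conj_symm v w, g1, inner_conj_symm, inner_sub_right,
      inner_smul_right, inner_smul_right, RCLike.re_to_complex, mul_sub, Complex.sub_re,
      mul_left_comm q, mul_left_comm q, Complex.re_ofReal_mul, Complex.re_ofReal_mul]
  have e3 : (q * inner ℂ (φ + q • (Gl - Gm)) Gm).re =
      (q * inner ℂ φ Gm).re + ‖q‖ ^ 2 * (P - Nm) := by
    rw [inner_add_left, mul_add, Complex.add_re, re_mul_inner_smul_left, inner_sub_left, ilm, im]
    norm_cast
  rw [norm_add_sq (𝕜 := ℂ) v, norm_smul, mul_pow, e1, e2, e3]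
  -- The terms linear in `q` cancel by Green's formula; the coefficient of `|q|²` is settled by the
  -- resolvent identity and the two norm formulas.
  linear_combination ‖q‖ ^ 2 * (hp - hnl + hnm)

/-- Uniqueness of the decomposition makes the choice in `anyonForm` harmless. -/
theorem anyonForm_eq_anyonExpr (hα0 : 0 < α) (hα1 : α < 1) (hl : 0 < lam) (β : ℝ) {φ : L2}
    {v : L2Field} (h : (φ, v) ∈ friedrichsGraph α) (q : ℂ) :
    anyonForm α β lam (φ + q • defectLp hα0 hα1 hl) = anyonExpr α β lam φ q := by
  have hex : ∃ p : L2 × ℂ, IsDecomposition α lam (φ + q • defectLp hα0 hα1 hl) p.1 p.2 :=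
    ⟨(φ, q), (isDecomposition_iff hα0 hα1 hl).2 ⟨mem_friedrichsDomain_iff.2 ⟨v, h⟩, rfl⟩⟩
  rw [anyonForm, dif_pos hex]
  obtain ⟨h1, h2⟩ := (isDecomposition_iff hα0 hα1 hl).1 hex.choose_spec
  obtain ⟨v', hv'⟩ := mem_friedrichsDomain_iff.1 h1
  obtain ⟨h3, h4⟩ := eq_of_add_smul_defectLp_eq hα0 hα1 hl h hv' h2
  rw [← h3, ← h4]

/-- The parameter of the decomposition is decoupled from the one in the definition of the form, so
that `μ` can later be adapted to `β`. -/
theorem anyonForm_eq_anyonExpr_of_pos (hα0 : 0 < α) (hα1 : α < 1) (hl : 0 < lam) (hm : 0 < mu)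
    (β : ℝ) {φ : L2} {v : L2Field} (h : (φ, v) ∈ friedrichsGraph α) (q : ℂ) :
    anyonForm α β lam (φ + q • defectLp hα0 hα1 hm) = anyonExpr α β mu φ q := by
  obtain ⟨φ', v', h', he, hE⟩ := exists_anyonExpr_eq hα0 hα1 hm hl β h q
  rw [he, anyonForm_eq_anyonExpr hα0 hα1 hl β h', hE]

theorem mem_anyonDomain_iff (hα0 : 0 < α) (hα1 : α < 1) (hl : 0 < lam) (hm : 0 < mu) {ψ : L2} :
    ψ ∈ anyonDomain α lam ↔
      ∃ (φ : L2) (v : L2Field) (q : ℂ),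
        (φ, v) ∈ friedrichsGraph α ∧ ψ = φ + q • defectLp hα0 hα1 hm := by
  constructor
  · rintro ⟨-, φ, q, hd⟩
    obtain ⟨h1, h2⟩ := (isDecomposition_iff hα0 hα1 hl).1 hd
    obtain ⟨v, hv⟩ := mem_friedrichsDomain_iff.1 h1
    obtain ⟨φ', v', h', he, -⟩ := exists_anyonExpr_eq hα0 hα1 hl hm 0 hv q
    exact ⟨φ', v', q, h', h2.trans he⟩
  · rintro ⟨φ, v, q, h, rfl⟩
    obtain ⟨φ', v', h', he, -⟩ := exists_anyonExpr_eq hα0 hα1 hm hl 0 h q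
    exact ⟨add_smul_defectLp_mem_L2even hα0 hα1 hm h.1 q, φ', q,
      (isDecomposition_iff hα0 hα1 hl).2 ⟨mem_friedrichsDomain_iff.2 ⟨v', h'⟩, he⟩⟩

/-! ### Sum of squares, lower bound and closedness -/

/-- The form, shifted by `μ²`, is a sum of squares. -/
theorem anyonForm_eq_sum_sq (hα0 : 0 < α) (hα1 : α < 1) (hl : 0 < lam) (hm : 0 < mu)
    (β : ℝ) {φ : L2} {v : L2Field} (h : (φ, v) ∈ friedrichsGraph α) (q : ℂ) :
    anyonForm α β lam (φ + q • defectLp hα0 hα1 hm) =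
      ‖v‖ ^ 2 + mu ^ 2 * ‖φ‖ ^ 2 + (β + cConst α * mu ^ (2 * α)) * ‖q‖ ^ 2
        - mu ^ 2 * ‖φ + q • defectLp hα0 hα1 hm‖ ^ 2 := by
  rw [anyonForm_eq_anyonExpr_of_pos hα0 hα1 hl hm β h, anyonExpr_eq hα0 hα1 hm β h.2.1]
  have hn := integral_defectProfile_sq hα0 hα1 hm
  have im := inner_defectLp hα0 hα1 hm hm
  have e1 : ‖defectLp hα0 hα1 hm‖ ^ 2 =
      ∫ x : Plane, defectProfile α mu (‖x‖ ^ 2) * defectProfile α mu (‖x‖ ^ 2) := by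
    rw [← inner_self_eq_norm_sq (𝕜 := ℂ), im, RCLike.re_to_complex, Complex.ofReal_re]
  rw [← e1] at hn
  rw [norm_add_sq (𝕜 := ℂ) φ, norm_smul, mul_pow, inner_smul_right, RCLike.re_to_complex]
  linear_combination ‖q‖ ^ 2 * hn

theorem cConst_pos (hα0 : 0 < α) (hα1 : α < 1) : 0 < cConst α := by
  rw [cConst_eq hα0 hα1]
  have : 0 < Real.sin (Real.pi * α) :=
    Real.sin_pos_of_pos_of_lt_pi (mul_pos Real.pi_pos hα0) (by nlinarith [Real.pi_pos])
  positivity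

theorem isLowerBoundForm_anyonForm (hα0 : 0 < α) (hα1 : α < 1) (hl : 0 < lam) (hm : 0 < mu)
    {β : ℝ} (hβ : 0 ≤ β + cConst α * mu ^ (2 * α)) :
    IsLowerBoundForm (anyonDomain α lam) (anyonForm α β lam) (-mu ^ 2) := by
  intro ψ hψ
  obtain ⟨φ, v, q, h, rfl⟩ := (mem_anyonDomain_iff hα0 hα1 hl hm).1 hψ
  rw [anyonForm_eq_sum_sq hα0 hα1 hl hm β h]
  have : 0 ≤ ‖v‖ ^ 2 + mu ^ 2 * ‖φ‖ ^ 2 + (β + cConst α * mu ^ (2 * α)) * ‖q‖ ^ 2 := by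
    positivity
  linarith

theorem tendsto_norm_of_mul_sq_le {ι : Type*} {l : Filter ι} {E : Type*} [SeminormedAddCommGroup E]
    {x : ι → E} {Q : ι → ℝ} {c : ℝ} (hc : 0 < c) (hQ : Tendsto Q l (𝓝 0))
    (hle : ∀ i, c * ‖x i‖ ^ 2 ≤ Q i) : Tendsto (fun i => ‖x i‖) l (𝓝 0) := by
  have h1 : Tendsto (fun i => ‖x i‖ ^ 2) l (𝓝 0) := by
    refine squeeze_zero (fun i => by positivity) (fun i => ?_)
      (by simpa using hQ.div_const c)
    rw [le_div_iff₀ hc, mul_comm]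
    exact hle i
  have := (Real.continuous_sqrt.tendsto 0).comp h1
  simpa [Function.comp_def, Real.sqrt_sq] using this

/-- With a positive coefficient of `|q|²`, the shifted form is equivalent to the squared norm of
`(v, φ, q)` in a product of complete spaces, and the admissible pairs `(φ, v)` form a closed
subspace. -/
theorem isClosedForm_anyonForm (hα0 : 0 < α) (hα1 : α < 1) (hl : 0 < lam) (β : ℝ) :
    IsClosedForm (anyonDomain α lam) (anyonForm α β lam) := by
  obtain ⟨mu, hm, hγ⟩ : ∃ mu : ℝ, 0 < mu ∧ 0 < β + cConst α * mu ^ (2 * α) := by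
    have h1 : Tendsto (fun mu : ℝ => β + cConst α * mu ^ (2 * α)) atTop atTop :=
      tendsto_atTop_add_const_left _ _
        ((tendsto_rpow_atTop (by positivity)).const_mul_atTop (cConst_pos hα0 hα1))
    obtain ⟨mu, h2, h3⟩ := ((h1.eventually_gt_atTop 0).and (eventually_gt_atTop 0)).exists
    exact ⟨mu, h3, h2⟩
  set γ := β + cConst α * mu ^ (2 * α) with hγdef
  have hm2 : 0 < mu ^ 2 := by positivity
  intro u w hu hlim hcau
  have hdec := fun n => (mem_anyonDomain_iff hα0 hα1 hl hm).1 (hu n)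
  choose φ v q hgr hueq using hdec
  have hform : ∀ (φ₁ φ₂ : L2) (v₁ v₂ : L2Field) (q₁ q₂ : ℂ), (φ₁, v₁) ∈ friedrichsGraph α →
      (φ₂, v₂) ∈ friedrichsGraph α →
      anyonForm α β lam ((φ₁ + q₁ • defectLp hα0 hα1 hm) - (φ₂ + q₂ • defectLp hα0 hα1 hm)) =
      ‖v₁ - v₂‖ ^ 2 + mu ^ 2 * ‖φ₁ - φ₂‖ ^ 2 + γ * ‖q₁ - q₂‖ ^ 2 - mu ^ 2 *
        ‖(φ₁ + q₁ • defectLp hα0 hα1 hm) - (φ₂ + q₂ • defectLp hα0 hα1 hm)‖ ^ 2 := by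
    intro φ₁ φ₂ v₁ v₂ q₁ q₂ h1 h2
    have h3 := sub_mem h1 h2
    rw [Prod.mk_sub_mk] at h3
    have e : (φ₁ + q₁ • defectLp hα0 hα1 hm) - (φ₂ + q₂ • defectLp hα0 hα1 hm) =
        (φ₁ - φ₂) + (q₁ - q₂) • defectLp hα0 hα1 hm := by
      rw [sub_smul]
      abel
    rw [e, anyonForm_eq_sum_sq hα0 hα1 hl hm β h3]
  -- The form itself may be negative; adding `μ² ‖·‖²`, which tends to 0 along the sequence, makes
  -- it a sum of nonnegative terms.
  let Q : ℕ × ℕ → ℝ := fun p => anyonForm α β lam (u p.1 - u p.2) + mu ^ 2 * ‖u p.1 - u p.2‖ ^ 2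
  have hQ : Tendsto Q atTop (𝓝 0) := by
    have h1 := cauchySeq_iff_tendsto_dist_atTop_0.1 hlim.cauchySeq
    simp only [dist_eq_norm] at h1
    simpa using hcau.add ((h1.pow 2).const_mul (mu ^ 2))
  have hQeq : ∀ p : ℕ × ℕ, Q p = ‖v p.1 - v p.2‖ ^ 2 + mu ^ 2 * ‖φ p.1 - φ p.2‖ ^ 2 +
      γ * ‖q p.1 - q p.2‖ ^ 2 := by
    intro p
    simp only [Q]
    rw [hueq p.1, hueq p.2, hform _ _ _ _ _ _ (hgr _) (hgr _)]
    ring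
  have cv : CauchySeq v := by
    rw [cauchySeq_iff_tendsto_dist_atTop_0]
    simp only [dist_eq_norm]
    refine tendsto_norm_of_mul_sq_le one_pos hQ fun p => ?_
    rw [hQeq, one_mul, add_assoc]
    exact le_add_of_nonneg_right (by positivity)
  have cφ : CauchySeq φ := by
    rw [cauchySeq_iff_tendsto_dist_atTop_0]
    simp only [dist_eq_norm]
    refine tendsto_norm_of_mul_sq_le hm2 hQ fun p => ?_
    have h1 : 0 ≤ ‖v p.1 - v p.2‖ ^ 2 := by positivity
    have h2 : 0 ≤ γ * ‖q p.1 - q p.2‖ ^ 2 := by positivity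
    rw [hQeq]
    linarith
  have cq : CauchySeq q := by
    rw [cauchySeq_iff_tendsto_dist_atTop_0]
    simp only [dist_eq_norm]
    refine tendsto_norm_of_mul_sq_le hγ hQ fun p => ?_
    rw [hQeq]
    exact le_add_of_nonneg_left (by positivity)
  obtain ⟨v', hv'⟩ := cauchySeq_tendsto_of_complete cv
  obtain ⟨φ', hφ'⟩ := cauchySeq_tendsto_of_complete cφ
  obtain ⟨q', hq'⟩ := cauchySeq_tendsto_of_complete cq
  have hgr' : (φ', v') ∈ friedrichsGraph α :=
    (isClosed_friedrichsGraph α).mem_of_tendsto (hφ'.prodMk_nhds hv') (Eventually.of_forall hgr)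
  have hw : w = φ' + q' • defectLp hα0 hα1 hm := by
    refine tendsto_nhds_unique hlim ?_
    have := hφ'.add (hq'.smul_const (defectLp hα0 hα1 hm))
    exact this.congr fun n => (hueq n).symm
  refine ⟨(mem_anyonDomain_iff hα0 hα1 hl hm).2 ⟨φ', v', q', hgr', hw⟩, ?_⟩
  have hn : ∀ {E : Type} [NormedAddCommGroup E] {x : ℕ → E} {y : E}, Tendsto x atTop (𝓝 y) →
      Tendsto (fun n => ‖x n - y‖ ^ 2) atTop (𝓝 0) := fun {E} _ {x y} h => by
    simpa using (tendsto_iff_norm_sub_tendsto_zero.1 h).pow 2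
  have := (((hn hv').add ((hn hφ').const_mul (mu ^ 2))).add ((hn hq').const_mul γ)).sub
    ((hn hlim).const_mul (mu ^ 2))
  simp only [mul_zero, add_zero, sub_zero] at this
  refine this.congr fun n => ?_
  rw [hw, hueq n, hform _ _ _ _ _ _ (hgr n) hgr']

end

/-! ### The theorem -/

theorem mainTheorem1 (α β : ℝ) (hα0 : 0 < α) (hα1 : α < 1) :
    (∀ lam mu : ℝ, 0 < lam → 0 < mu → ∀ (ψ φ : L2) (q : ℂ), IsDecomposition α mu ψ φ q →
      ψ ∈ anyonDomain α lam ∧ anyonForm α β lam ψ = anyonExpr α β mu φ q) ∧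
    ∀ lam : ℝ, 0 < lam →
      IsClosedForm (anyonDomain α lam) (anyonForm α β lam) ∧
      (0 ≤ β → IsLowerBoundForm (anyonDomain α lam) (anyonForm α β lam) 0) ∧
      (β < 0 → IsLowerBoundForm (anyonDomain α lam) (anyonForm α β lam)
        (-(|β| * Real.sin (Real.pi * α) / Real.pi ^ 2) ^ (1 / α))) := by
  refine ⟨fun lam mu hl hm ψ φ q hd => ?_, fun lam hl =>
    ⟨isClosedForm_anyonForm hα0 hα1 hl β, fun hβ ψ hψ => ?_, fun hβ => ?_⟩⟩
  · obtain ⟨h1, rfl⟩ := (isDecomposition_iff hα0 hα1 hm).1 hd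
    obtain ⟨v, hv⟩ := mem_friedrichsDomain_iff.1 h1
    exact ⟨(mem_anyonDomain_iff hα0 hα1 hl hm).2 ⟨φ, v, q, hv, rfl⟩,
      anyonForm_eq_anyonExpr_of_pos hα0 hα1 hl hm β hv q⟩
  · rw [zero_mul]
    -- For `β ≥ 0` every `μ > 0` is admissible; `μ² = ε / (‖ψ‖² + 1)` makes the loss `μ² ‖ψ‖²` at
    -- most `ε`, the `+ 1` covering `ψ = 0`.
    refine le_of_forall_pos_le_add fun ε hε => ?_
    have hN : 0 < ‖ψ‖ ^ 2 + 1 := by positivity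
    have hm : 0 < Real.sqrt (ε / (‖ψ‖ ^ 2 + 1)) := Real.sqrt_pos.2 (by positivity)
    have hc := cConst_pos hα0 hα1
    have h := isLowerBoundForm_anyonForm hα0 hα1 hl hm (β := β) (by positivity) ψ hψ
    rw [Real.sq_sqrt (by positivity)] at h
    have h2 : ε / (‖ψ‖ ^ 2 + 1) * ‖ψ‖ ^ 2 ≤ ε := by
      rw [div_mul_eq_mul_div, div_le_iff₀ hN]
      linarith
    linarith
  · have hc := cConst_pos hα0 hα1
    have hX : |β| * Real.sin (Real.pi * α) / Real.pi ^ 2 = |β| / cConst α := by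
      rw [cConst_eq hα0 hα1, div_div_eq_mul_div]
    rw [hX]
    have hX0 : 0 < |β| / cConst α := div_pos (abs_pos.2 hβ.ne) hc
    -- This `μ` solves `β + c_α μ^{2α} = 0`, the smallest value at which the coefficient of `|q|²`
    -- is nonnegative.
    have hm : 0 < Real.sqrt ((|β| / cConst α) ^ (1 / α)) := Real.sqrt_pos.2 (by positivity)
    have hsq : Real.sqrt ((|β| / cConst α) ^ (1 / α)) ^ 2 = (|β| / cConst α) ^ (1 / α) :=
      Real.sq_sqrt (by positivity)
    have h := isLowerBoundForm_anyonForm hα0 hα1 hl hm (β := β) (by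
      rw [← sq_rpow hm.le, hsq, ← Real.rpow_mul hX0.le, one_div_mul_cancel hα0.ne', Real.rpow_one,
        mul_div_cancel₀ _ hc.ne', abs_of_neg hβ]
      linarith)
    rwa [hsq] at h
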